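/- Let $n, n' \ge 1$ and $d \ge 2$ be integers, and put $$p := 1 + \frac{n'd}{n+1}, \qquad q := \binom{n+d}{d}\, p .$$ For an $n'$-tuple $r = (r_1,\dots,r_{n'})$ of real polynomials in $n$ variables of degree at most $d$, let $\mu_r$ be the measure on the graph of $r$ in $\mathbb R^n\times\mathbb R^{n'}$ given by $$\int \varphi(x,y)\, d\mu_r(x,y) := \int_{\mathbb R^n} \varphi\bigl(t, r_1(t),\dots,r_{n'}(t)\bigr)\, dt .$$ Let $f \in L^p(\mathbb R^n\times\mathbb R^{n'})$ be real- or complex-valued. Then for almost every $r$ (with respect to Lebesgue measure on the coefficients of the $n'$-tuples of polynomials of degree at most $d$), the integral defining $$f\star\mu_r(x,y) = \int_{\mathbb R^n} f\bigl(x-t,\, y-r(t)\bigr)\, dt$$ converges absolutely for almost every $(x,y) \in \mathbb R^n\times\mathbb R^{n'}$, and $$\| f\star\mu_r\|_{L^q(\mathbb R^n\times\mathbb R^{n'})} < \infty .$$ -/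

import Mathlib

open MeasureTheory

/-- The multiindices of length `n` and degree at most `d`. -/
def multiIndices (n d : ℕ) : Finset (Fin n → ℕ) :=
  (Fintype.piFinset fun _ : Fin n => Finset.range (d + 1)).filter fun α => ∑ i, α i ≤ d

theorem mem_multiIndices {n d : ℕ} (α : Fin n → ℕ) :
    α ∈ multiIndices n d ↔ ∑ i, α i ≤ d := by
  simp only [multiIndices, Finset.mem_filter, Fintype.mem_piFinset, Finset.mem_range,
    and_iff_right_iff_imp]
  intro h i
  have := Finset.single_le_sum (f := α) (fun _ _ => Nat.zero_le _) (Finset.mem_univ i)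
  omega

/-- The space of `n'`-tuples of real polynomials of degree at most `d` in `n` variables, given by
their coefficients: `r α j` is the coefficient of `t ^ α` in the `j`-th polynomial. As a finite
power of `ℝ` it carries Lebesgue measure. -/
abbrev PolyTuple (n n' d : ℕ) : Type := multiIndices n d → Fin n' → ℝ

/-- The polynomial map `t ↦ (r₁(t), …, r_{n'}(t))` with the given coefficients. -/
def polyMap {n n' d : ℕ} (r : PolyTuple n n' d) (t : Fin n → ℝ) : Fin n' → ℝ :=
  fun j => ∑ α : multiIndices n d, r α j * ∏ i, t i ^ (α : Fin n → ℕ) i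

theorem measurable_polyMap {n n' d : ℕ} (r : PolyTuple n n' d) : Measurable (polyMap r) := by
  unfold polyMap
  fun_prop

/-- The measure on the graph of `r` that is the image of Lebesgue measure `dt` under
`t ↦ (t, r(t))`. -/
noncomputable def graphMeasure {n n' d : ℕ} (r : PolyTuple n n' d) :
    Measure ((Fin n → ℝ) × (Fin n' → ℝ)) :=
  Measure.map (fun t : Fin n → ℝ => (t, polyMap r t)) volume

/-- The defining property of the graph measure. -/
theorem lintegral_graphMeasure {n n' d : ℕ} (r : PolyTuple n n' d)
    {φ : (Fin n → ℝ) × (Fin n' → ℝ) → ENNReal} (hφ : Measurable φ) :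
    ∫⁻ w, φ w ∂(graphMeasure r) = ∫⁻ t : Fin n → ℝ, φ (t, polyMap r t) :=
  lintegral_map hφ (measurable_id.prodMk (measurable_polyMap r))

/-- The convolution `(f ⋆ μ)(z) = ∫ f(z - w) dμ(w)` of a function with a measure. -/
noncomputable def convMeasure {G 𝕜 : Type*} [AddGroup G] [MeasurableSpace G] [RCLike 𝕜]
    (f : G → 𝕜) (μ : Measure G) (z : G) : 𝕜 :=
  ∫ w, f (z - w) ∂μ

/-! Put X g(r) = ∫ g(s, r(s)) ds, and let D be the number of multiindices, so that q = Dp.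
Substituting t = x - s bounds |f ⋆ μ_r|(x, y) by X|f| at the tuple y - r(x - ·), which is
`reflectTuple (x, y) r`. Two facts then suffice: (X|f|)^q is integrable over coefficient space
(`lintegral_polyTuple_rpow_le`), and an integrable function of r has finite integral over almost
every orbit z ↦ `reflectTuple z r` (`ae_lintegral_reflectTuple_lt_top`).

The first fact rests on (∫ g)^(Dp) ≤ C ∫ |det V(s)|^n' ∏ g(s_i)^p ds, where V(s) is the matrix of
all monomials at D points (`lintegral_rpow_le_lintegral_enorm_det`). Take g(s) = |f(s, r(s))| and
integrate in r: for fixed points, r ↦ (r(s_1), …, r(s_D)) is linear with determinant ±(det V)^n',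
which cancels the weight and leaves (∫ |f|^p)^D. For the inequality itself, the determinant integral
dominates the product of the minimal weighted moments of polynomials monic in the lexicographic
order (`prod_iInf_le_lintegral_enorm_det`). Near-minimisers form a unitriangular family, and Hölder
reduces the claim to integrating a negative power of the maximum of this family
(`lintegral_rowMax_rpow_le`), which is done by slicing and one-variable sublevel estimates.

For the second fact, z acts by volume-preserving involutions, so Fubini exchanges F along orbits for
a weight w along orbits. The weight is positive almost everywhere with orbit integrals at most 1:
certain coefficients of degree d - 1 move affinely in x, through a matrix of top coefficients that
is almost surely invertible because d ≥ 2, and r(0) records the translation in y. -/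

/-! ### One-variable sublevel sets and layer-cake integration. -/

/-- Factor over ℂ: a real point at distance at least ρ from the real part of every root has |P| ≥
|leading coefficient| · ρ^deg. The sublevel set thus lies in at most deg intervals of length 2ρ. -/
theorem Polynomial.volume_abs_eval_lt_le (P : Polynomial ℝ) (hP : 0 < P.natDegree) {l : ℝ}
    (hl : 0 < l) :
    volume {t : ℝ | |P.eval t| < l} ≤
      ENNReal.ofReal (2 * P.natDegree * (l / |P.leadingCoeff|) ^ (1 / P.natDegree : ℝ)) := by
  have hb : 0 < |P.leadingCoeff| := by
    rw [abs_pos]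
    intro h
    rw [Polynomial.leadingCoeff_eq_zero] at h
    simp [h] at hP
  set ρ : ℝ := (l / |P.leadingCoeff|) ^ (1 / P.natDegree : ℝ) with hρ
  have hρ0 : 0 ≤ ρ := by positivity
  have hρpow : ρ ^ P.natDegree = l / |P.leadingCoeff| := by
    rw [hρ, ← Real.rpow_natCast, ← Real.rpow_mul (by positivity),
      one_div_mul_cancel (by exact_mod_cast hP.ne'), Real.rpow_one]
  set Pc := P.map (algebraMap ℝ ℂ) with hPc
  have hsplit : Pc.Splits := IsAlgClosed.splits Pc
  have hcard : Pc.roots.card = P.natDegree := by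
    rw [← hsplit.natDegree_eq_card_roots, hPc, Polynomial.natDegree_map]
  have hsub : {t : ℝ | |P.eval t| < l} ⊆
      ⋃ z ∈ Pc.roots.toFinset, Set.Ioo (z.re - ρ) (z.re + ρ) := by
    intro t ht
    by_contra hnot
    simp only [Set.mem_iUnion, not_exists, Multiset.mem_toFinset] at hnot
    have h1 : ∀ z ∈ Pc.roots, ρ ≤ ‖(t : ℂ) - z‖ := by
      intro z hz
      have h2 := hnot z hz
      refine le_trans ?_ (Complex.abs_re_le_norm _)
      simp only [Complex.sub_re, Complex.ofReal_re]
      by_contra h3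
      push Not at h3
      rw [abs_lt] at h3
      exact h2 ⟨by linarith, by linarith⟩
    have h3 : ρ ^ P.natDegree ≤ (Pc.roots.map fun z => ‖(t : ℂ) - z‖).prod := by
      rw [← hcard]
      clear hcard hsplit hnot
      revert h1
      generalize Pc.roots = m
      intro h1
      induction m using Multiset.induction_on with
      | empty => simp
      | cons z s ih =>
        simp only [Multiset.card_cons, Multiset.map_cons, Multiset.prod_cons]
        rw [pow_succ']
        exact mul_le_mul (h1 z (by simp)) (ih fun w hw => h1 w (by simp [hw])) (by positivity)
          (norm_nonneg _)
    have h4 : |P.eval t| = |P.leadingCoeff| * (Pc.roots.map fun z => ‖(t : ℂ) - z‖).prod := by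
      have h5 := hsplit.eval_eq_prod_roots (t : ℂ)
      have h6 : Pc.eval (t : ℂ) = ((P.eval t : ℝ) : ℂ) := by
        have := Polynomial.eval_map_algebraMap (B := ℂ) P (t : ℂ)
        rw [hPc, this]
        exact Polynomial.aeval_algebraMap_apply_eq_algebraMap_eval t P
      rw [h6] at h5
      have h7 := congrArg norm h5
      rw [Complex.norm_real, norm_mul, Real.norm_eq_abs] at h7
      rw [h7]
      congr 1
      · rw [hPc, Polynomial.leadingCoeff_map]; simp
      · exact (map_multiset_prod (normHom : ℂ →*₀ ℝ) _).trans (by simp [Multiset.map_map])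
    have ht' : |P.eval t| < l := ht
    rw [h4] at ht'
    have : l ≤ |P.leadingCoeff| * (Pc.roots.map fun z => ‖(t : ℂ) - z‖).prod := by
      calc l = |P.leadingCoeff| * (l / |P.leadingCoeff|) := by field_simp
        _ ≤ _ := by rw [← hρpow]; gcongr
    linarith
  calc volume {t : ℝ | |P.eval t| < l}
      ≤ volume (⋃ z ∈ Pc.roots.toFinset, Set.Ioo (z.re - ρ) (z.re + ρ)) := measure_mono hsub
    _ ≤ ∑ z ∈ Pc.roots.toFinset, volume (Set.Ioo (z.re - ρ) (z.re + ρ)) :=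
        measure_biUnion_finset_le _ _
    _ = Pc.roots.toFinset.card * ENNReal.ofReal (2 * ρ) := by
        have h8 : ∀ z : ℂ, z.re + ρ - (z.re - ρ) = 2 * ρ := fun z => by ring
        simp only [Real.volume_Ioo, h8, Finset.sum_const, nsmul_eq_mul]
    _ ≤ P.natDegree * ENNReal.ofReal (2 * ρ) := by
        gcongr
        rw [← hcard]
        exact Multiset.toFinset_card_le _
    _ = _ := by
        rw [← ENNReal.ofReal_natCast, ← ENNReal.ofReal_mul (by positivity)]
        congr 1
        ring

/-- Using a formal degree `k` avoids any nonvanishing hypothesis: if the coefficient of X^k is zero,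
the bound is `⊤`. -/
theorem Polynomial.volume_mul_abs_eval_lt_le (P : Polynomial ℝ) {k : ℕ} (hk : 0 < k)
    (hP : P.natDegree ≤ k) {a : ℝ} (ha : 0 < a) {l : ℝ} (hl : 0 < l) :
    volume {t : ℝ | ENNReal.ofReal (a * |P.eval t|) < ENNReal.ofReal l} ≤
      ENNReal.ofReal (2 * k) *
        (ENNReal.ofReal l / ENNReal.ofReal (a * |P.coeff k|)) ^ (1 / k : ℝ) := by
  have hset : {t : ℝ | ENNReal.ofReal (a * |P.eval t|) < ENNReal.ofReal l} =
      {t : ℝ | |P.eval t| < l / a} := by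
    ext t
    simp only [Set.mem_ofPred_eq]
    rw [ENNReal.ofReal_lt_ofReal_iff hl, lt_div_iff₀' ha]
  rw [hset]
  have hk' : (0 : ℝ) < k := by exact_mod_cast hk
  rcases eq_or_ne (P.coeff k) 0 with h0 | h0
  · have : ENNReal.ofReal l / ENNReal.ofReal (a * |P.coeff k|) = ⊤ := by
      rw [h0]
      simp [ENNReal.div_zero, hl]
    rw [this, ENNReal.top_rpow_of_pos (by positivity), ENNReal.mul_top]
    · exact le_top
    · simp [hk.ne']
  · have hdeg : P.natDegree = k := le_antisymm hP (Polynomial.le_natDegree_of_ne_zero h0)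
    have h1 := P.volume_abs_eval_lt_le (hdeg ▸ hk) (div_pos hl ha)
    refine h1.trans_eq ?_
    rw [Polynomial.leadingCoeff, hdeg, ← ENNReal.ofReal_div_of_pos (by positivity),
      ENNReal.ofReal_rpow_of_nonneg (by positivity) (by positivity),
      ← ENNReal.ofReal_mul (by positivity), div_div]

theorem lintegral_Ioi_rpow (x : ENNReal) {σ : ℝ} (hσ : 0 < σ) :
    ∫⁻ l in Set.Ioi (0 : ℝ), Set.indicator {l : ℝ | x < ENNReal.ofReal l}
      (fun l => ENNReal.ofReal l ^ (-σ - 1)) l = ENNReal.ofReal (1 / σ) * x ^ (-σ) := by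
  have hpos : ∀ b : ℝ, 0 < b → ∫⁻ l in Set.Ioi b, ENNReal.ofReal l ^ (-σ - 1) =
      ENNReal.ofReal (1 / σ) * ENNReal.ofReal b ^ (-σ) := by
    intro b hb
    have h1 : ∫⁻ l in Set.Ioi b, ENNReal.ofReal l ^ (-σ - 1) =
        ∫⁻ l in Set.Ioi b, ENNReal.ofReal (l ^ (-σ - 1)) :=
      setLIntegral_congr_fun measurableSet_Ioi fun l hl =>
        ENNReal.ofReal_rpow_of_pos (hb.trans hl)
    rw [h1, ← ofReal_integral_eq_lintegral_ofReal
      (integrableOn_Ioi_rpow_of_lt (by linarith) hb), integral_Ioi_rpow_of_lt (by linarith) hb,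
      ENNReal.ofReal_rpow_of_pos hb, ← ENNReal.ofReal_mul (by positivity)]
    · congr 1
      rw [show -σ - 1 + 1 = -σ by ring]
      field_simp
    · filter_upwards [ae_restrict_mem measurableSet_Ioi] with l hl
      have : 0 < l := hb.trans hl
      simp only [Pi.zero_apply]
      positivity
  have hmeas : MeasurableSet {l : ℝ | x < ENNReal.ofReal l} :=
    measurableSet_lt measurable_const ENNReal.measurable_ofReal
  rw [lintegral_indicator hmeas, Measure.restrict_restrict hmeas]
  induction x with
  | top => simp [hσ]
  | coe x =>
    rcases eq_or_ne x 0 with rfl | hx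
    · have hset : {l : ℝ | ((0 : NNReal) : ENNReal) < ENNReal.ofReal l} ∩ Set.Ioi 0 =
          Set.Ioi (0 : ℝ) := by
        ext l; simp
      rw [hset, ENNReal.coe_zero, ENNReal.zero_rpow_of_neg (by linarith), ENNReal.mul_top (by simpa)]
      rw [eq_top_iff]
      -- At `x = 0` both sides are infinite; the divergence is read off from the integrals over (b,
      -- ∞) as b → 0.
      have htend : Filter.Tendsto (fun b : ℝ => ENNReal.ofReal (1 / σ) * ENNReal.ofReal b ^ (-σ))
          (nhdsWithin 0 (Set.Ioi 0)) (nhds ⊤) := by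
        have h2 : Filter.Tendsto (fun b : ℝ => ENNReal.ofReal b ^ (-σ))
            (nhdsWithin 0 (Set.Ioi 0)) (nhds ⊤) := by
          have h3 : Filter.Tendsto (fun b : ℝ => ENNReal.ofReal b) (nhds 0) (nhds 0) := by
            simpa using (ENNReal.continuous_ofReal.tendsto 0)
          have h4 := ((ENNReal.continuous_rpow_const (y := -σ)).tendsto 0).comp h3
          rw [ENNReal.zero_rpow_of_neg (by linarith)] at h4
          exact h4.mono_left nhdsWithin_le_nhds
        have h5 := ENNReal.Tendsto.const_mul (a := ENNReal.ofReal (1 / σ)) h2 (Or.inl (by simp))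
        rwa [ENNReal.mul_top (by simpa)] at h5
      refine le_of_tendsto htend ?_
      filter_upwards [self_mem_nhdsWithin] with b hb
      rw [← hpos b hb]
      exact lintegral_mono_set (Set.Ioi_subset_Ioi (le_of_lt hb))
    · have hset : {l : ℝ | (x : ENNReal) < ENNReal.ofReal l} ∩ Set.Ioi 0 = Set.Ioi (x : ℝ) := by
        ext l
        simp only [Set.mem_inter_iff, Set.mem_ofPred_eq, Set.mem_Ioi]
        rw [← ENNReal.ofReal_coe_nnreal, ENNReal.ofReal_lt_ofReal_iff']
        constructor
        · rintro ⟨⟨h, _⟩, _⟩; exact h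
        · intro h; have := lt_of_le_of_lt x.2 h; exact ⟨⟨h, this⟩, this⟩
      rw [hset, hpos x (by positivity), ENNReal.ofReal_coe_nnreal]

theorem ENNReal.rpow_sum_of_nonneg' {ι : Type*} (x : ENNReal) (s : Finset ι) {f : ι → ℝ}
    (hf : ∀ i ∈ s, 0 ≤ f i) : x ^ (∑ i ∈ s, f i) = ∏ i ∈ s, x ^ f i := by
  classical
  induction s using Finset.induction_on with
  | empty => simp
  | insert a s ha ih =>
    rw [Finset.sum_insert ha, Finset.prod_insert ha,
      ENNReal.rpow_add_of_nonneg _ _ (hf a (by simp))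
        (Finset.sum_nonneg fun i hi => hf i (by simp [hi])), ih fun i hi => hf i (by simp [hi])]

/-- The sublevel bounds are combined in a geometric mean with weights k η_k, which sum to 1, giving
measure at most C l^(S - η₀) ∏ q_k^(-η_k) with S the sum of all η_k. Integrating against S l^(-S-1)
leaves l^(-η₀-1), which converges at infinity; below `q 0` the sublevel set is empty, and this
supplies the factor q₀^(-η₀). -/
theorem lintegral_rpow_neg_le_prod {Q : ℝ → ENNReal} (hQ : Measurable Q) (d : ℕ)
    (q : ℕ → ENNReal) (C : ENNReal) {η : ℕ → ℝ} (hη : ∀ k, 0 < η k)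
    (hsum : ∑ k ∈ Finset.range d, (k + 1) * η (k + 1) = 1) (h0 : ∀ t, q 0 ≤ Q t)
    (hsub : ∀ k ∈ Finset.range d, ∀ l : ℝ, 0 < l → volume {t | Q t < ENNReal.ofReal l} ≤
      C * (ENNReal.ofReal l / q (k + 1)) ^ (1 / (k + 1) : ℝ)) :
    ∫⁻ t, Q t ^ (-∑ k ∈ Finset.range (d + 1), η k) ≤
      ENNReal.ofReal (∑ k ∈ Finset.range (d + 1), η k) * (C * ENNReal.ofReal (1 / η 0)) *
        ∏ k ∈ Finset.range (d + 1), q k ^ (-η k) := by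
  set S := ∑ k ∈ Finset.range (d + 1), η k with hS
  have hS0 : 0 < S := Finset.sum_pos (fun k _ => hη k) ⟨0, by simp⟩
  have hbound : ∀ l : ℝ, 0 < l → volume {t | Q t < ENNReal.ofReal l} ≤
      C * (ENNReal.ofReal l ^ (S - η 0) * ∏ k ∈ Finset.range d, q (k + 1) ^ (-η (k + 1))) := by
    intro l hl
    set m := volume {t | Q t < ENNReal.ofReal l}
    have hSη : S - η 0 = ∑ k ∈ Finset.range d, η (k + 1) := by
      rw [hS, Finset.sum_range_succ']; ring
    calc m = ∏ k ∈ Finset.range d, m ^ ((k + 1) * η (k + 1)) := by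
          rw [← ENNReal.rpow_sum_of_nonneg', hsum, ENNReal.rpow_one]
          intro k _
          have := hη (k + 1)
          positivity
      _ ≤ ∏ k ∈ Finset.range d, (C ^ ((k + 1) * η (k + 1)) *
            (ENNReal.ofReal l ^ η (k + 1) * q (k + 1) ^ (-η (k + 1)))) := by
          refine Finset.prod_le_prod' fun k hk => ?_
          have hk0 := hη (k + 1)
          refine (ENNReal.rpow_le_rpow (hsub k hk l hl) (by positivity)).trans_eq ?_
          rw [ENNReal.mul_rpow_of_nonneg _ _ (by positivity), ← ENNReal.rpow_mul]
          congr 1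
          rw [show 1 / ((k : ℝ) + 1) * ((k + 1) * η (k + 1)) = η (k + 1) by field_simp,
            ENNReal.div_rpow_of_nonneg _ _ hk0.le, ENNReal.rpow_neg, div_eq_mul_inv]
      _ = _ := by
          rw [Finset.prod_mul_distrib, Finset.prod_mul_distrib, ← ENNReal.rpow_sum_of_nonneg',
            hsum, ENNReal.rpow_one, ← ENNReal.rpow_sum_of_nonneg', hSη]
          · intro k _; exact (hη _).le
          · intro k _
            have := hη (k + 1)
            positivity
  set R0 := ∏ k ∈ Finset.range d, q (k + 1) ^ (-η (k + 1)) with hR0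
  have hmeas : Measurable (Function.uncurry fun (t l : ℝ) =>
      Set.indicator {l : ℝ | Q t < ENNReal.ofReal l}
        (fun l => ENNReal.ofReal l ^ (-S - 1)) l) := by
    have : (Function.uncurry fun (t l : ℝ) => Set.indicator {l : ℝ | Q t < ENNReal.ofReal l}
        (fun l => ENNReal.ofReal l ^ (-S - 1)) l) =
        Set.indicator {x : ℝ × ℝ | Q x.1 < ENNReal.ofReal x.2}
          (fun x => ENNReal.ofReal x.2 ^ (-S - 1)) := by
      ext ⟨t, l⟩
      simp [Set.indicator]
    rw [this]
    refine Measurable.indicator (by fun_prop) ?_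
    exact measurableSet_lt (hQ.comp measurable_fst) (by fun_prop)
  calc ∫⁻ t, Q t ^ (-S)
      = ∫⁻ t, ENNReal.ofReal S * ∫⁻ l in Set.Ioi (0 : ℝ),
          Set.indicator {l : ℝ | Q t < ENNReal.ofReal l}
            (fun l => ENNReal.ofReal l ^ (-S - 1)) l := by
        refine lintegral_congr fun t => ?_
        rw [lintegral_Ioi_rpow _ hS0, ← mul_assoc, ← ENNReal.ofReal_mul hS0.le,
          mul_one_div_cancel hS0.ne', ENNReal.ofReal_one, one_mul]
    _ = ENNReal.ofReal S * ∫⁻ l in Set.Ioi (0 : ℝ), ∫⁻ t,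
          Set.indicator {l : ℝ | Q t < ENNReal.ofReal l}
            (fun l => ENNReal.ofReal l ^ (-S - 1)) l := by
        rw [lintegral_const_mul' _ _ ENNReal.ofReal_ne_top,
          lintegral_lintegral_swap hmeas.aemeasurable]
    _ ≤ ENNReal.ofReal S * ∫⁻ l in Set.Ioi (0 : ℝ), C * R0 *
          Set.indicator {l : ℝ | q 0 < ENNReal.ofReal l}
            (fun l => ENNReal.ofReal l ^ (-η 0 - 1)) l := by
        refine mul_le_mul_right (setLIntegral_mono' measurableSet_Ioi fun l hl => ?_) _
        have hl' : (0 : ℝ) < l := hl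
        have h1 : ∫⁻ t, Set.indicator {l : ℝ | Q t < ENNReal.ofReal l}
            (fun l => ENNReal.ofReal l ^ (-S - 1)) l =
            ENNReal.ofReal l ^ (-S - 1) * volume {t | Q t < ENNReal.ofReal l} := by
          rw [← lintegral_indicator_const (measurableSet_lt hQ measurable_const)]
          refine lintegral_congr fun t => ?_
          simp [Set.indicator]
        rw [h1]
        by_cases hql : q 0 < ENNReal.ofReal l
        · rw [Set.indicator_of_mem (by exact hql)]
          refine (mul_le_mul_right (hbound l hl') _).trans_eq ?_
          have h2 : ENNReal.ofReal l ^ (-η 0 - 1) =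
              ENNReal.ofReal l ^ (-S - 1) * ENNReal.ofReal l ^ (S - η 0) := by
            rw [← ENNReal.rpow_add _ _ (by simpa using hl') ENNReal.ofReal_ne_top]
            congr 1; ring
          rw [h2]; ring
        · have : {t | Q t < ENNReal.ofReal l} = ∅ := by
            ext t
            simp only [Set.mem_ofPred_eq, Set.mem_empty_iff_false, iff_false]
            exact fun h => hql ((h0 t).trans_lt h)
          simp [this]
    _ ≤ ENNReal.ofReal S * (C * R0 * (ENNReal.ofReal (1 / η 0) * q 0 ^ (-η 0))) := by
        rw [lintegral_const_mul, lintegral_Ioi_rpow _ (hη 0)]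
        exact Measurable.indicator (by fun_prop)
          (measurableSet_lt measurable_const ENNReal.measurable_ofReal)
    _ = _ := by
        rw [Finset.prod_range_succ' (fun k => q k ^ (-η k))]
        ring

/-! ### Counting multiindices by their first exponent. -/

/-- This is the total of the first exponents over all multiindices in n + 1 variables. It is what
makes the weights in `lintegral_rowMax_rpow_le` satisfy Σ k η_k = 1. -/
theorem sum_range_mul_choose (n d : ℕ) :
    ∑ k ∈ Finset.range (d + 1), k * (n + (d - k)).choose n = (n + 1 + d).choose (n + 2) := by
  induction d with
  | zero => simp
  | succ d ih =>
    rw [Finset.sum_range_succ']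
    have h1 : ∀ k ∈ Finset.range (d + 1), (k + 1) * (n + (d + 1 - (k + 1))).choose n =
        k * (n + (d - k)).choose n + (n + (d - k)).choose n := by
      intro k _
      rw [Nat.add_sub_add_right]; ring
    rw [Finset.sum_congr rfl h1, Finset.sum_add_distrib, ih]
    have h2 : ∑ k ∈ Finset.range (d + 1), (n + (d - k)).choose n = (n + 1 + d).choose (n + 1) := by
      have := Finset.sum_range_reflect (fun k => (n + k).choose n) (d + 1)
      simp only [Nat.add_sub_cancel] at this
      rw [this]
      have h3 := Nat.sum_range_add_choose d n
      simp only [add_comm n _]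
      rw [h3]
      congr 1 <;> omega
    rw [h2]
    have := Nat.choose_succ_succ (n + 1 + d) (n + 1)
    rw [show n + 1 + (d + 1) = (n + 1 + d).succ by omega, this]
    simp
    ring

theorem mem_multiIndices_cons {n d k : ℕ} {β : Fin n → ℕ} :
    (Fin.cons k β : Fin (n + 1) → ℕ) ∈ multiIndices (n + 1) d ↔
      k ∈ Finset.range (d + 1) ∧ β ∈ multiIndices n (d - k) := by
  simp only [mem_multiIndices, Fin.sum_univ_succ, Fin.cons_zero, Fin.cons_succ, Finset.mem_range]
  omega

theorem prod_multiIndices_succ {M : Type*} [CommMonoid M] (n d : ℕ)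
    (f : (Fin (n + 1) → ℕ) → M) :
    ∏ α ∈ multiIndices (n + 1) d, f α =
      ∏ k ∈ Finset.range (d + 1), ∏ β ∈ multiIndices n (d - k), f (Fin.cons k β) := by
  rw [Finset.prod_sigma']
  refine Finset.prod_bij' (fun α _ => ⟨α 0, Fin.tail α⟩) (fun x _ => Fin.cons x.1 x.2)
    ?_ ?_ ?_ ?_ ?_
  · intro α hα
    rw [Finset.mem_sigma]
    rwa [← Fin.cons_self_tail α, mem_multiIndices_cons] at hα
  · rintro ⟨k, β⟩ h
    rw [Finset.mem_sigma] at h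
    exact mem_multiIndices_cons.2 h
  · intro α _; simp
  · rintro ⟨k, β⟩ _; simp
  · intro α _; simp

theorem sum_multiIndices_succ {M : Type*} [AddCommMonoid M] (n d : ℕ)
    (f : (Fin (n + 1) → ℕ) → M) :
    ∑ α ∈ multiIndices (n + 1) d, f α =
      ∑ k ∈ Finset.range (d + 1), ∑ β ∈ multiIndices n (d - k), f (Fin.cons k β) :=
  prod_multiIndices_succ (M := Multiplicative M) n d f

theorem card_multiIndices (n d : ℕ) : (multiIndices n d).card = (n + d).choose n := by
  induction n generalizing d with
  | zero =>
    have : multiIndices 0 d = Finset.univ :=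
      Finset.eq_univ_iff_forall.2 fun α => by simp [mem_multiIndices]
    simp [this]
  | succ n ih =>
    rw [Finset.card_eq_sum_ones, sum_multiIndices_succ]
    simp only [← Finset.card_eq_sum_ones, ih]
    have := Finset.sum_range_reflect (fun k => (n + k).choose n) (d + 1)
    simp only [Nat.add_sub_cancel] at this
    rw [this]
    have h3 := Nat.sum_range_add_choose d n
    simp only [add_comm n _]
    rw [h3]
    congr 1 <;> omega

/-! ### Negative powers of the maximum of a unitriangular family. -/

/-- `c` is lower unitriangular for the lexicographic order on multiindices. -/
structure IsUnitriangular {n : ℕ} (c : (Fin n → ℕ) → (Fin n → ℕ) → ℝ) : Prop where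
  diag : ∀ α, c α α = 1
  eq_zero : ∀ α β, toLex α < toLex β → c α β = 0

/-- The polynomial of degree at most `d` whose coefficients are the row `c α`. -/
noncomputable def rowPoly (n d : ℕ) (c : (Fin n → ℕ) → (Fin n → ℕ) → ℝ) (α : Fin n → ℕ)
    (s : Fin n → ℝ) : ℝ :=
  ∑ β ∈ multiIndices n d, c α β * ∏ i, s i ^ β i

/-- The largest of the weighted polynomials `a α * |rowPoly n d c α|`. -/
noncomputable def rowMax (n d : ℕ) (a : (Fin n → ℕ) → ℝ) (c : (Fin n → ℕ) → (Fin n → ℕ) → ℝ)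
    (s : Fin n → ℝ) : ENNReal :=
  (multiIndices n d).sup fun α => ENNReal.ofReal (a α * |rowPoly n d c α s|)

theorem measurable_rowPoly (n d : ℕ) (c : (Fin n → ℕ) → (Fin n → ℕ) → ℝ) (α : Fin n → ℕ) :
    Measurable (rowPoly n d c α) := by
  unfold rowPoly
  fun_prop

theorem measurable_rowMax (n d : ℕ) (a : (Fin n → ℕ) → ℝ) (c : (Fin n → ℕ) → (Fin n → ℕ) → ℝ) :
    Measurable (rowMax n d a c) := by
  unfold rowMax
  simp only [Finset.sup_eq_iSup]
  refine Measurable.iSup fun α => Measurable.iSup fun _ => ?_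
  exact (measurable_const.mul
    (measurable_norm.comp (measurable_rowPoly n d c α))).ennreal_ofReal

theorem le_rowMax {n d : ℕ} (a : (Fin n → ℕ) → ℝ) (c : (Fin n → ℕ) → (Fin n → ℕ) → ℝ)
    {α : Fin n → ℕ} (hα : α ∈ multiIndices n d) (s : Fin n → ℝ) :
    ENNReal.ofReal (a α * |rowPoly n d c α s|) ≤ rowMax n d a c s :=
  Finset.le_sup (f := fun α => ENNReal.ofReal (a α * |rowPoly n d c α s|)) hα

theorem zero_mem_multiIndices (n d : ℕ) : (0 : Fin n → ℕ) ∈ multiIndices n d := by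
  simp [mem_multiIndices]

theorem exists_rowMax_eq {n d : ℕ} (a : (Fin n → ℕ) → ℝ) (c : (Fin n → ℕ) → (Fin n → ℕ) → ℝ)
    (s : Fin n → ℝ) : ∃ α ∈ multiIndices n d,
      rowMax n d a c s = ENNReal.ofReal (a α * |rowPoly n d c α s|) :=
  Finset.exists_mem_eq_sup _ ⟨0, zero_mem_multiIndices n d⟩ _

theorem rowMax_ne_top {n d : ℕ} (a : (Fin n → ℕ) → ℝ) (c : (Fin n → ℕ) → (Fin n → ℕ) → ℝ)
    (s : Fin n → ℝ) : rowMax n d a c s ≠ ⊤ := by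
  obtain ⟨α, _, h⟩ := exists_rowMax_eq (d := d) a c s
  rw [h]
  exact ENNReal.ofReal_ne_top

theorem toLex_cons_lt_of_head_lt {n k l : ℕ} (h : k < l) (α β : Fin n → ℕ) :
    toLex (Fin.cons k α : Fin (n + 1) → ℕ) < toLex (Fin.cons l β : Fin (n + 1) → ℕ) :=
  ⟨0, fun j hj => absurd hj (by simp), by simpa using h⟩

theorem toLex_cons_lt_of_tail_lt {n k : ℕ} {α β : Fin n → ℕ} (h : toLex α < toLex β) :
    toLex (Fin.cons k α : Fin (n + 1) → ℕ) < toLex (Fin.cons k β : Fin (n + 1) → ℕ) := by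
  obtain ⟨i, hi, hlt⟩ := h
  refine ⟨i.succ, fun j hj => ?_, by simpa using hlt⟩
  induction j using Fin.cases with
  | zero => simp
  | succ j => simpa using hi j (by simpa using hj)

/-- The block of the rows and columns with first exponent `k`. -/
def rowBlock {n : ℕ} (c : (Fin (n + 1) → ℕ) → (Fin (n + 1) → ℕ) → ℝ) (k : ℕ) :
    (Fin n → ℕ) → (Fin n → ℕ) → ℝ :=
  fun α β => c (Fin.cons k α) (Fin.cons k β)

theorem IsUnitriangular.rowBlock {n : ℕ} {c : (Fin (n + 1) → ℕ) → (Fin (n + 1) → ℕ) → ℝ}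
    (hc : IsUnitriangular c) (k : ℕ) : IsUnitriangular (rowBlock c k) :=
  ⟨fun _ => hc.diag _, fun _ _ h => hc.eq_zero _ _ (toLex_cons_lt_of_tail_lt h)⟩

/-- The restriction of `rowPoly (n + 1) d c α` to the line in direction of the first coordinate
through `s`. -/
noncomputable def linePoly (n d : ℕ) (c : (Fin (n + 1) → ℕ) → (Fin (n + 1) → ℕ) → ℝ)
    (α : Fin (n + 1) → ℕ) (s : Fin n → ℝ) : Polynomial ℝ :=
  ∑ β ∈ multiIndices (n + 1) d, Polynomial.C (c α β * ∏ i, s i ^ β (Fin.succ i)) *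
    Polynomial.X ^ β 0

theorem eval_linePoly (n d : ℕ) (c : (Fin (n + 1) → ℕ) → (Fin (n + 1) → ℕ) → ℝ)
    (α : Fin (n + 1) → ℕ) (s : Fin n → ℝ) (t : ℝ) :
    (linePoly n d c α s).eval t = rowPoly (n + 1) d c α (Fin.cons t s) := by
  rw [linePoly, rowPoly, Polynomial.eval_finsetSum]
  refine Finset.sum_congr rfl fun β _ => ?_
  simp only [Polynomial.eval_mul, Polynomial.eval_C, Polynomial.eval_pow, Polynomial.eval_X,
    Fin.prod_univ_succ, Fin.cons_zero, Fin.cons_succ]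
  ring

/-- A column with first exponent above `k` is lexicographically larger than the row, so its entry
vanishes. Together with `coeff_linePoly`, the leading coefficient in the first variable is again a
row polynomial, in one variable fewer. -/
theorem natDegree_linePoly_le {n d : ℕ} {c : (Fin (n + 1) → ℕ) → (Fin (n + 1) → ℕ) → ℝ}
    (hc : IsUnitriangular c) (k : ℕ) (α : Fin n → ℕ) (s : Fin n → ℝ) :
    (linePoly n d c (Fin.cons k α) s).natDegree ≤ k := by
  refine Polynomial.natDegree_sum_le_of_forall_le _ _ fun β _ => ?_
  rcases le_or_gt (β 0) k with h | h
  · exact (Polynomial.natDegree_C_mul_X_pow_le _ _).trans h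
  · have : c (Fin.cons k α) β = 0 := by
      rw [← Fin.cons_self_tail β]
      exact hc.eq_zero _ _ (toLex_cons_lt_of_head_lt h _ _)
    simp [this]

theorem coeff_linePoly {n d : ℕ} (c : (Fin (n + 1) → ℕ) → (Fin (n + 1) → ℕ) → ℝ)
    {k : ℕ} (hk : k ≤ d) (α : Fin n → ℕ) (s : Fin n → ℝ) :
    (linePoly n d c (Fin.cons k α) s).coeff k = rowPoly n (d - k) (rowBlock c k) α s := by
  rw [linePoly, sum_multiIndices_succ, Polynomial.finsetSum_coeff,
    Finset.sum_eq_single_of_mem k (by simp; omega)]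
  · simp only [Polynomial.finsetSum_coeff, rowPoly, rowBlock, Polynomial.coeff_C_mul,
      Polynomial.coeff_X_pow, Fin.cons_zero, Fin.cons_succ, if_true, mul_one]
  · intro l _ hl
    simp only [Polynomial.finsetSum_coeff, Polynomial.coeff_C_mul, Polynomial.coeff_X_pow,
      Fin.cons_zero, hl.symm, if_false, mul_zero, Finset.sum_const_zero]

theorem lintegral_fin_succ {n : ℕ} {F : (Fin (n + 1) → ℝ) → ENNReal} (hF : Measurable F) :
    ∫⁻ s, F s = ∫⁻ s : Fin n → ℝ, ∫⁻ t : ℝ, F (Fin.cons t s) := by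
  have h := (volume_preserving_piFinSuccAbove (fun _ : Fin (n + 1) => ℝ) 0).symm
  rw [← h.lintegral_comp hF, Measure.volume_eq_prod,
    lintegral_prod_symm' (fun x => F ((MeasurableEquiv.piFinSuccAbove (fun _ : Fin (n + 1) => ℝ) 0).symm x)) (hF.comp h.measurable)]
  simp [MeasurableEquiv.piFinSuccAbove, Fin.insertNthEquiv]

/-- Induction on the number of variables. On a line in the first coordinate, the rows with first
exponent k have degree at most k and their X^k coefficients form a unitriangular family in the other
variables. `lintegral_rpow_neg_le_prod` integrates along the line; Hölder and the induction
hypothesis in degree d - k handle the rest. The constant does not depend on `a` or `c`. -/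
theorem lintegral_rowMax_rpow_le (n : ℕ) : ∀ d : ℕ, 1 ≤ d → ∃ C : ENNReal, C ≠ ⊤ ∧
    ∀ a : (Fin n → ℕ) → ℝ, (∀ α, 0 < a α) →
    ∀ c : (Fin n → ℕ) → (Fin n → ℕ) → ℝ, IsUnitriangular c →
    ∫⁻ s, rowMax n d a c s ^ (-(((n : ℝ) + 1) / d)) ≤
      C * ∏ α ∈ multiIndices n d,
        ENNReal.ofReal (a α) ^ (-(((n : ℝ) + 1) / (d * (multiIndices n d).card))) := by
  induction n with
  | zero =>
    intro d hd
    refine ⟨1, ENNReal.one_ne_top, fun a ha c hc => ?_⟩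
    have hu : multiIndices 0 d = {default} := by
      ext α; simp [mem_multiIndices, Subsingleton.elim α default]
    have h1 : ∀ s, rowMax 0 d a c s = ENNReal.ofReal (a default) := by
      intro s
      simp [rowMax, rowPoly, hu, hc.diag]
    simp [h1, hu, volume_pi]
  | succ n ih =>
    intro d hd
    have hd' : (0 : ℝ) < d := by exact_mod_cast hd
    choose! C hC hbound using ih
    set Dk : ℕ → ℕ := fun k => (multiIndices n (d - k)).card with hDk
    have hDk0 : ∀ k, 0 < Dk k := fun k => Finset.card_pos.2 ⟨0, zero_mem_multiIndices n _⟩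
    set D := (multiIndices (n + 1) d).card with hD
    have hD0 : 0 < D := Finset.card_pos.2 ⟨0, zero_mem_multiIndices _ _⟩
    have hD0' : (0 : ℝ) < D := by exact_mod_cast hD0
    have hDsum : ∑ k ∈ Finset.range (d + 1), Dk k = D := by
      rw [hD, Finset.card_eq_sum_ones, sum_multiIndices_succ]
      simp [hDk]
    -- Weights proportional to the block sizes give every `a α` the same final exponent -c0; the
    -- normalisation makes both Σ η_k = (n + 2)/d and Σ k η_k = 1 true.
    set c0 : ℝ := ((n : ℝ) + 2) / (d * D) with hc0
    have hc0' : 0 < c0 := by positivity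
    set η : ℕ → ℝ := fun k => c0 * Dk k with hη
    have hη0 : ∀ k, 0 < η k := fun k => mul_pos hc0' (by exact_mod_cast hDk0 k)
    have hηsum : ∑ k ∈ Finset.range (d + 1), η k = ((n : ℝ) + 2) / d := by
      rw [hη, ← Finset.mul_sum, ← Nat.cast_sum, hDsum, hc0]
      field_simp
    have hηmom : ∑ k ∈ Finset.range (d + 1), (k : ℝ) * η k = 1 := by
      have h1 : ∑ k ∈ Finset.range (d + 1), k * Dk k = (n + 1 + d).choose (n + 2) := by
        simp only [hDk, card_multiIndices]
        exact sum_range_mul_choose n d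
      have h2 : ((n + 1 + d).choose (n + 2) : ℝ) * (n + 2) = D * d := by
        rw [hD, card_multiIndices]
        have := Nat.choose_succ_right_eq (n + 1 + d) (n + 1)
        rw [show n + 1 + d - (n + 1) = d by omega] at this
        exact_mod_cast this
      have h3 : ∑ k ∈ Finset.range (d + 1), (k : ℝ) * η k =
          c0 * ((n + 1 + d).choose (n + 2) : ℝ) := by
        rw [← h1, Nat.cast_sum, Finset.mul_sum]
        refine Finset.sum_congr rfl fun k _ => ?_
        simp only [hη]; push_cast; ring
      rw [h3, hc0, div_mul_eq_mul_div, mul_comm ((n : ℝ) + 2), h2, mul_comm]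
      exact div_self (by positivity)
    have hηmom' : ∑ k ∈ Finset.range d, ((k : ℝ) + 1) * η (k + 1) = 1 := by
      rw [Finset.sum_range_succ'] at hηmom
      simpa using hηmom
    -- Hölder exponents turning q_k^(-η_k) into a power of the integrand of the induction
    -- hypothesis. They sum to 1 because Σ (d - k) η_k = n + 1.
    set p : ℕ → ℝ := fun k => η k * (d - k : ℕ) / (n + 1) with hp
    have hpsum : ∑ k ∈ Finset.range d, p k = 1 := by
      have h1 : ∑ k ∈ Finset.range (d + 1), p k = 1 := by
        have h2 : ∀ k ∈ Finset.range (d + 1), p k = (d * η k - k * η k) / (n + 1) := by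
          intro k hk
          simp only [hp]
          rw [Nat.cast_sub (by simpa [Nat.lt_succ_iff] using hk)]
          ring
        rw [Finset.sum_congr rfl h2, ← Finset.sum_div, Finset.sum_sub_distrib, ← Finset.mul_sum,
          hηsum, hηmom]
        field_simp
        ring
      rw [Finset.sum_range_succ] at h1
      simpa [hp] using h1
    set K : ENNReal := ENNReal.ofReal (∑ k ∈ Finset.range (d + 1), η k) *
      (ENNReal.ofReal (2 * d) * ENNReal.ofReal (1 / η 0)) with hK
    have hKtop : K ≠ ⊤ := by
      simp [hK, ENNReal.mul_eq_top]
    refine ⟨K * ∏ k ∈ Finset.range d, C (d - k) ^ p k, ?_, fun a ha c hc => ?_⟩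
    · refine ENNReal.mul_ne_top hKtop (ENNReal.prod_ne_top fun k hk => ?_)
      exact ENNReal.rpow_ne_top_of_nonneg (by have := hη0 k; positivity)
        (hC _ (by simp at hk; omega))
    set q : ℕ → (Fin n → ℝ) → ENNReal := fun k s =>
      rowMax n (d - k) (fun β => a (Fin.cons k β)) (rowBlock c k) s with hq
    have hfiber : ∀ s : Fin n → ℝ, ∫⁻ t : ℝ, rowMax (n + 1) d a c (Fin.cons t s) ^
        (-∑ k ∈ Finset.range (d + 1), η k) ≤ K * ∏ k ∈ Finset.range (d + 1), q k s ^ (-η k) := by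
      intro s
      refine lintegral_rpow_neg_le_prod ?_ d (fun k => q k s) (ENNReal.ofReal (2 * d)) hη0 hηmom'
        ?_ ?_
      · refine (measurable_rowMax _ _ _ _).comp (measurable_pi_lambda _ fun i => ?_)
        induction i using Fin.cases with
        | zero => simpa using measurable_id'
        | succ i => simp
      -- Rows with first exponent 0 are constant along the line, so their maximum bounds `rowMax`
      -- from below there.
      · intro t
        refine Finset.sup_le fun β hβ => ?_
        have h1 : rowPoly n (d - 0) (rowBlock c 0) β s =
            rowPoly (n + 1) d c (Fin.cons 0 β) (Fin.cons t s) := by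
          rw [← coeff_linePoly c (Nat.zero_le d), ← eval_linePoly,
            Polynomial.eq_C_of_natDegree_le_zero (natDegree_linePoly_le hc 0 β s)]
          simp
        rw [h1]
        exact le_rowMax a c (mem_multiIndices_cons.2 ⟨by simp, hβ⟩) _
      · intro k hk l hl
        have hkd : k + 1 ≤ d := by simpa using hk
        obtain ⟨β, hβ, hβq⟩ := exists_rowMax_eq (d := d - (k + 1))
          (fun β => a (Fin.cons (k + 1) β)) (rowBlock c (k + 1)) s
        have h1 := (linePoly n d c (Fin.cons (k + 1) β) s).volume_mul_abs_eval_lt_le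
          (Nat.succ_pos k) (natDegree_linePoly_le hc (k + 1) β s) (ha (Fin.cons (k + 1) β)) hl
        rw [coeff_linePoly c hkd, ← hβq] at h1
        refine (measure_mono fun t ht => ?_).trans (h1.trans ?_)
        · rw [Set.mem_ofPred_eq] at ht ⊢
          rw [eval_linePoly]
          refine lt_of_le_of_lt (le_rowMax a c (mem_multiIndices_cons.2 ⟨?_, hβ⟩) _) ht
          simp; omega
        · push_cast
          gcongr
          exact_mod_cast hkd
    have hu : multiIndices n 0 = {0} := by
      ext α
      simp [mem_multiIndices, funext_iff]
    -- The block k = d is a single constant. The induction hypothesis does not cover degree 0, but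
    -- here p_d = 0 and the factor leaves the integral.
    have hqd : ∀ s, q d s = ENNReal.ofReal (a (Fin.cons d 0)) := by
      intro s
      simp only [hq]
      rw [rowMax, Nat.sub_self, hu]
      simp [rowPoly, hu, (hc.rowBlock d).diag]
    have hexp : -((((n + 1 : ℕ) : ℝ) + 1) / d) = -∑ k ∈ Finset.range (d + 1), η k := by
      rw [hηsum]; push_cast; ring
    have hexp' : -((((n + 1 : ℕ) : ℝ) + 1) / (d * D)) = -c0 := by
      rw [hc0]; push_cast; ring
    rw [hexp, hexp', lintegral_fin_succ ((measurable_rowMax _ _ _ _).pow_const _)]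
    have hprod : ∏ α ∈ multiIndices (n + 1) d, ENNReal.ofReal (a α) ^ (-c0) =
        (∏ k ∈ Finset.range d, ∏ β ∈ multiIndices n (d - k),
          ENNReal.ofReal (a (Fin.cons k β)) ^ (-c0)) *
        ENNReal.ofReal (a (Fin.cons d 0)) ^ (-η d) := by
      rw [prod_multiIndices_succ, Finset.prod_range_succ, Nat.sub_self, hu, Finset.prod_singleton]
      simp [hη, hDk, hu]
    have hpk : ∀ k, 0 ≤ p k := fun k => by have := hη0 k; positivity
    calc ∫⁻ s : Fin n → ℝ, ∫⁻ t : ℝ, rowMax (n + 1) d a c (Fin.cons t s) ^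
          (-∑ k ∈ Finset.range (d + 1), η k)
        ≤ ∫⁻ s, K * ((∏ k ∈ Finset.range d,
            (q k s ^ (-(((n : ℝ) + 1) / (d - k : ℕ)))) ^ p k) *
              ENNReal.ofReal (a (Fin.cons d 0)) ^ (-η d)) := by
          refine lintegral_mono fun s => (hfiber s).trans_eq ?_
          rw [Finset.prod_range_succ, hqd]
          congr 2
          refine Finset.prod_congr rfl fun k hk => ?_
          rw [← ENNReal.rpow_mul]
          congr 1
          have : (0 : ℝ) < (d - k : ℕ) := by simp at hk; exact_mod_cast (by omega)
          simp only [hp]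
          field_simp
      _ = K * ((∫⁻ s, ∏ k ∈ Finset.range d,
            (q k s ^ (-(((n : ℝ) + 1) / (d - k : ℕ)))) ^ p k) *
              ENNReal.ofReal (a (Fin.cons d 0)) ^ (-η d)) := by
          rw [lintegral_const_mul' _ _ hKtop, lintegral_mul_const']
          rw [ENNReal.ofReal_rpow_of_pos (ha _)]
          exact ENNReal.ofReal_ne_top
      _ ≤ K * ((∏ k ∈ Finset.range d,
            (∫⁻ s, q k s ^ (-(((n : ℝ) + 1) / (d - k : ℕ)))) ^ p k) *
              ENNReal.ofReal (a (Fin.cons d 0)) ^ (-η d)) := by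
          gcongr
          exact ENNReal.lintegral_prod_norm_pow_le _
            (fun k _ => ((measurable_rowMax _ _ _ _).pow_const _).aemeasurable) hpsum
            fun k _ => hpk k
      _ ≤ K * ((∏ k ∈ Finset.range d, (C (d - k) ^ p k *
            ∏ β ∈ multiIndices n (d - k), ENNReal.ofReal (a (Fin.cons k β)) ^ (-c0))) *
              ENNReal.ofReal (a (Fin.cons d 0)) ^ (-η d)) := by
          gcongr with k hk
          have hk' : 1 ≤ d - k := by simp at hk; omega
          have : (0 : ℝ) < (d - k : ℕ) := by exact_mod_cast hk'
          have h3 : (0 : ℝ) < (multiIndices n (d - k)).card := by exact_mod_cast hDk0 k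
          refine (ENNReal.rpow_le_rpow (hbound (d - k) hk' _ (fun β => ha (Fin.cons k β)) _
            (hc.rowBlock k)) (hpk k)).trans_eq ?_
          rw [ENNReal.mul_rpow_of_nonneg _ _ (hpk k), ← ENNReal.prod_rpow_of_nonneg (hpk k)]
          congr 1
          refine Finset.prod_congr rfl fun β _ => ?_
          rw [← ENNReal.rpow_mul]
          congr 1
          simp only [hp, hη, hDk]
          field_simp
      _ = _ := by
          rw [hprod, Finset.prod_mul_distrib]
          ring

/-! ### Lower bound for determinant integrals. -/

theorem enorm_mul_pow_mul_iInf_le {X : Type*} [MeasurableSpace X] (μ : Measure X) {γ : ℕ}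
    (hγ : γ ≠ 0) (e : ℕ → X → ℝ) (h : X → ENNReal) (N : ℕ) (M : ℝ) (w : ℕ → ℝ) :
    ‖M‖ₑ ^ γ * (⨅ c : ℕ → ℝ, ∫⁻ x, ‖e N x + ∑ k ∈ Finset.range N, c k * e k x‖ₑ ^ γ * h x ∂μ) ≤
      ∫⁻ x, ‖M * e N x + ∑ k ∈ Finset.range N, w k * e k x‖ₑ ^ γ * h x ∂μ := by
  rcases eq_or_ne M 0 with rfl | hM
  · simp [hγ]
  · refine (mul_le_mul_right (iInf_le _ fun k => w k / M) _).trans ?_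
    rw [← lintegral_const_mul' _ _ (ENNReal.pow_ne_top enorm_ne_top)]
    refine lintegral_mono fun x => le_of_eq ?_
    rw [← mul_assoc, ← mul_pow, ← enorm_mul, mul_add, Finset.mul_sum]
    congr 4
    refine Finset.sum_congr rfl fun k _ => ?_
    field_simp

theorem lintegral_fin_snoc {X : Type*} [MeasurableSpace X] (μ : Measure X) [SigmaFinite μ] {N : ℕ}
    {F : (Fin (N + 1) → X) → ENNReal} (hF : Measurable F) :
    ∫⁻ s, F s ∂(Measure.pi fun _ => μ) =
      ∫⁻ s : Fin N → X, ∫⁻ x, F (Fin.snoc s x) ∂μ ∂(Measure.pi fun _ => μ) := by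
  have h := (measurePreserving_piFinSuccAbove (fun _ : Fin (N + 1) => μ) (Fin.last N)).symm
  rw [← h.lintegral_comp hF, lintegral_prod_symm' (fun x => F
    ((MeasurableEquiv.piFinSuccAbove (fun _ : Fin (N + 1) => X) (Fin.last N)).symm x))
    (hF.comp h.measurable)]
  simp [MeasurableEquiv.piFinSuccAbove, Fin.insertNthEquiv, Fin.insertNth_last']

/-- Expand along the row of the last point: as a function of that point the determinant is the
smaller determinant times `e N` plus a combination of earlier functions. Its weighted moment is
therefore at least |minor|^γ times the minimal moment, and induction applies. -/
theorem prod_iInf_le_lintegral_enorm_det {X : Type*} [MeasurableSpace X] (μ : Measure X)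
    [SigmaFinite μ] {γ : ℕ} (hγ : γ ≠ 0) {e : ℕ → X → ℝ} (he : ∀ k, Measurable (e k))
    {h : X → ENNReal} (hh : Measurable h) (N : ℕ) :
    ∏ j ∈ Finset.range N,
        (⨅ c : ℕ → ℝ, ∫⁻ x, ‖e j x + ∑ k ∈ Finset.range j, c k * e k x‖ₑ ^ γ * h x ∂μ) ≤
      ∫⁻ s : Fin N → X, ‖(Matrix.of fun i j : Fin N => e j (s i)).det‖ₑ ^ γ * ∏ i, h (s i)
        ∂(Measure.pi fun _ => μ) := by
  have hdet : ∀ N : ℕ, Measurable fun s : Fin N → X =>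
      ‖(Matrix.of fun i j : Fin N => e j (s i)).det‖ₑ ^ γ * ∏ i, h (s i) := by
    intro N
    refine Measurable.mul (Measurable.pow_const (Measurable.enorm ?_) _)
      (Finset.measurable_prod _ fun i _ => hh.comp (measurable_pi_apply i))
    simp only [Matrix.det_apply, Matrix.of_apply]
    refine Finset.measurable_sum _ fun σ _ => Measurable.const_smul
      (Finset.measurable_prod _ fun i _ => (he _).comp (measurable_pi_apply _)) _
  induction N with
  | zero => simp
  | succ N ih =>
    rw [Finset.prod_range_succ]
    set mN := ⨅ c : ℕ → ℝ, ∫⁻ x, ‖e N x + ∑ k ∈ Finset.range N, c k * e k x‖ₑ ^ γ * h x ∂μ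
    rw [lintegral_fin_snoc μ (hdet (N + 1))]
    rw [mul_comm]
    refine (mul_le_mul_right ih _).trans ((lintegral_const_mul_le _ _).trans ?_)
    refine lintegral_mono fun s => ?_
    set M := (Matrix.of fun i j : Fin N => e j (s i)).det
    obtain ⟨w, hw⟩ : ∃ w : ℕ → ℝ, ∀ x, (Matrix.of fun i j : Fin (N + 1) =>
        e j ((Fin.snoc s x : Fin (N + 1) → X) i)).det =
        M * e N x + ∑ k ∈ Finset.range N, w k * e k x := by
      -- The coefficients are the signed cofactors of the last row; the value 0 beyond `N` is never
      -- used.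
      refine ⟨fun k => if hk : k < N then (-1) ^ (N + k) *
        (Matrix.of fun i j : Fin N => e ((Fin.castSucc ⟨k, hk⟩ : Fin (N + 1)).succAbove j)
          (s i)).det else 0, fun x => ?_⟩
      rw [Matrix.det_succ_row _ (Fin.last N), Fin.sum_univ_castSucc, add_comm]
      congr 1
      · simp only [Matrix.of_apply, Fin.snoc_last, Fin.val_last, Fin.succAbove_last]
        rw [← two_mul, pow_mul, neg_one_sq, one_pow, one_mul, mul_comm]
        congr 2
        ext i j
        simp [Matrix.submatrix_apply]
      · rw [Finset.sum_range]
        refine Finset.sum_congr rfl fun k _ => ?_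
        simp only [Matrix.of_apply, Fin.snoc_last, Fin.val_last, Fin.succAbove_last, Fin.is_lt,
          dif_pos, Fin.val_castSucc, Fin.eta]
        rw [mul_right_comm]
        congr 3
        ext i j
        simp [Matrix.submatrix_apply]
    simp only [hw, Fin.prod_univ_castSucc, Fin.snoc_castSucc, Fin.snoc_last]
    have h1 := enorm_mul_pow_mul_iInf_le μ hγ e h N M w
    calc mN * (‖M‖ₑ ^ γ * ∏ i, h (s i)) = (∏ i, h (s i)) * (‖M‖ₑ ^ γ * mN) := by ring
      _ ≤ (∏ i, h (s i)) *
          ∫⁻ x, ‖M * e N x + ∑ k ∈ Finset.range N, w k * e k x‖ₑ ^ γ * h x ∂μ := by gcongr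
      _ ≤ ∫⁻ x, (∏ i, h (s i)) *
          (‖M * e N x + ∑ k ∈ Finset.range N, w k * e k x‖ₑ ^ γ * h x) ∂μ :=
        lintegral_const_mul_le _ _
      _ = _ := lintegral_congr fun x => by ring

/-! ### The pointwise inequality for ∫ g. -/

theorem exists_lex_enumeration (n d : ℕ) : ∃ e : ℕ → (Fin n → ℕ),
    (multiIndices n d) = (Finset.range (multiIndices n d).card).image e ∧
    ∀ i j, i < j → j < (multiIndices n d).card → toLex (e i) < toLex (e j) := by
  classical
  set S : Finset (Lex (Fin n → ℕ)) := (multiIndices n d).map toLex.toEmbedding with hS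
  have hcard : S.card = (multiIndices n d).card := Finset.card_map _
  set φ := S.orderEmbOfFin hcard
  refine ⟨fun k => if hk : k < (multiIndices n d).card then ofLex (φ ⟨k, hk⟩) else 0, ?_, ?_⟩
  · ext α
    simp only [Finset.mem_image, Finset.mem_range]
    have hrange := Finset.range_orderEmbOfFin S hcard
    have hmem : α ∈ multiIndices n d ↔ toLex α ∈ Set.range φ := by
      rw [hrange]
      simp [hS]
    rw [hmem]
    constructor
    · rintro ⟨⟨k, hk⟩, h⟩
      exact ⟨k, hk, by simp only [hk, dif_pos]; rw [h]; rfl⟩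
    · rintro ⟨k, hk, h⟩
      simp only [hk, dif_pos] at h
      exact ⟨⟨k, hk⟩, by rw [← h]; rfl⟩
  · intro i j hij hj
    simp only [hj, hij.trans hj, dif_pos]
    exact φ.strictMono (by simpa using hij)

/-- The monomial function `s ↦ s ^ α`. -/
def monomialFun {n : ℕ} (α : Fin n → ℕ) (s : Fin n → ℝ) : ℝ := ∏ i, s i ^ α i

theorem continuous_monomialFun {n : ℕ} (α : Fin n → ℕ) : Continuous (monomialFun α) := by
  unfold monomialFun
  fun_prop

/-- Hölder applied to g = (g Q^(γ/p)) · Q^(-γ/p), with Q the weighted maximum. The value of p makes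
the dual power of the second factor exactly Q^(-(n+1)/d). -/
theorem lintegral_rpow_le_of_rowMax {n d γ : ℕ} (hd : 1 ≤ d) (hγ : 1 ≤ γ) {p : ℝ}
    (hp : p = 1 + (γ * d : ℝ) / (n + 1)) : ∃ C : ENNReal, C ≠ ⊤ ∧
    ∀ g : (Fin n → ℝ) → ENNReal, Measurable g →
    ∀ (a : (Fin n → ℕ) → ℝ) (c : (Fin n → ℕ) → (Fin n → ℕ) → ℝ), (∀ α, 0 < a α) →
    IsUnitriangular c → (∀ α ∈ multiIndices n d,
      ∫⁻ s, ‖rowPoly n d c α s‖ₑ ^ γ * g s ^ p ≤ ENNReal.ofReal (a α)) →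
    (∫⁻ s, g s) ^ ((multiIndices n d).card * p) ≤
      C * ∏ α ∈ multiIndices n d, ENNReal.ofReal (a α) := by
  obtain ⟨C, hC, hkey⟩ := lintegral_rowMax_rpow_le n d hd
  set D := (multiIndices n d).card with hD
  have hD0 : (0 : ℝ) < D := by
    exact_mod_cast Finset.card_pos.2 ⟨0, zero_mem_multiIndices n d⟩
  have hd0 : (0 : ℝ) < d := by exact_mod_cast hd
  have hγ0 : (0 : ℝ) < γ := by exact_mod_cast hγ
  have hp1 : p - 1 = (γ * d : ℝ) / (n + 1) := by rw [hp]; ring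
  have hp1' : 0 < p - 1 := by rw [hp1]; positivity
  have hp0 : 0 < p := by linarith
  refine ⟨((D : ENNReal) * C ^ (p - 1)) ^ D, ENNReal.pow_ne_top (ENNReal.mul_ne_top (by simp)
    (ENNReal.rpow_ne_top_of_nonneg hp1'.le hC)), fun g hg a c ha hc hint => ?_⟩
  -- This normalises each weighted moment to at most 1, whence ∫ g^p Q^γ ≤ D.
  set b : (Fin n → ℕ) → ℝ := fun α => a α ^ (-(1 / γ : ℝ)) with hb
  have hb0 : ∀ α, 0 < b α := fun α => Real.rpow_pos_of_pos (ha α) _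
  set Q := rowMax n d b c with hQ
  have hQm : Measurable Q := measurable_rowMax n d b c
  have hQtop : ∀ s, Q s ≠ ⊤ := rowMax_ne_top b c
  have hkey' := hkey b hb0 c hc
  have hbpow : ∀ α, ENNReal.ofReal (b α) ^ (-(((n : ℝ) + 1) / (d * D))) =
      ENNReal.ofReal (a α) ^ (((n : ℝ) + 1) / (γ * d * D)) := by
    intro α
    rw [hb, ← ENNReal.ofReal_rpow_of_pos (ha α), ← ENNReal.rpow_mul]
    congr 1
    field_simp
  simp only [hbpow] at hkey'
  have hfin : ∫⁻ s, Q s ^ (-(((n : ℝ) + 1) / d)) ≠ ⊤ := by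
    refine ne_top_of_le_ne_top (ENNReal.mul_ne_top hC (ENNReal.prod_ne_top fun α _ => ?_)) hkey'
    exact ENNReal.rpow_ne_top_of_nonneg (by positivity) ENNReal.ofReal_ne_top
  have hQ0 : ∀ᵐ s, Q s ≠ 0 := by
    filter_upwards [ae_lt_top (hQm.pow_const _) hfin] with s hs h0
    rw [h0, ENNReal.zero_rpow_of_neg (by rw [neg_lt_zero]; positivity)] at hs
    exact lt_irrefl _ hs
  have hgQ : ∫⁻ s, g s ^ p * Q s ^ γ ≤ D := by
    calc ∫⁻ s, g s ^ p * Q s ^ γ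
        ≤ ∫⁻ s, ∑ α ∈ multiIndices n d,
            (ENNReal.ofReal (a α))⁻¹ * (‖rowPoly n d c α s‖ₑ ^ γ * g s ^ p) := by
          refine lintegral_mono fun s => ?_
          obtain ⟨α, hα, h⟩ := exists_rowMax_eq (d := d) b c s
          have h1 : g s ^ p * Q s ^ γ =
              (ENNReal.ofReal (a α))⁻¹ * (‖rowPoly n d c α s‖ₑ ^ γ * g s ^ p) := by
            rw [hQ, h, ENNReal.ofReal_mul (hb0 α).le, mul_pow, Real.enorm_eq_ofReal_abs]
            have h2 : ENNReal.ofReal (b α) ^ γ = (ENNReal.ofReal (a α))⁻¹ := by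
              rw [hb, ← ENNReal.ofReal_rpow_of_pos (ha α), ← ENNReal.rpow_natCast,
                ← ENNReal.rpow_mul, ← ENNReal.rpow_neg_one]
              congr 1
              field_simp
            rw [h2]; ring
          rw [h1]
          exact Finset.single_le_sum (f := fun α => (ENNReal.ofReal (a α))⁻¹ *
            (‖rowPoly n d c α s‖ₑ ^ γ * g s ^ p)) (fun _ _ => zero_le) hα
      _ = ∑ α ∈ multiIndices n d,
            (ENNReal.ofReal (a α))⁻¹ * ∫⁻ s, ‖rowPoly n d c α s‖ₑ ^ γ * g s ^ p := by
          have hm : ∀ α, Measurable fun s => ‖rowPoly n d c α s‖ₑ ^ γ * g s ^ p := fun α =>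
            ((measurable_rowPoly n d c α).enorm.pow_const _).mul (hg.pow_const _)
          rw [lintegral_finsetSum _ fun α _ => (hm α).const_mul _]
          exact Finset.sum_congr rfl fun α _ => lintegral_const_mul _ (hm α)
      _ ≤ ∑ α ∈ multiIndices n d, 1 := by
          refine Finset.sum_le_sum fun α hα => ?_
          refine (mul_le_mul_right (hint α hα) _).trans_eq
            (ENNReal.inv_mul_cancel ?_ ENNReal.ofReal_ne_top)
          simpa using ha α
      _ = D := by simp [hD]
  have hconj : p.HolderConjugate (p / (p - 1)) := Real.HolderConjugate.conjExponent (by linarith)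
  have hholder := ENNReal.lintegral_mul_le_Lp_mul_Lq volume hconj
    (f := fun s => g s * Q s ^ (γ / p)) (g := fun s => Q s ^ (-(γ / p)))
    (hg.mul (hQm.pow_const _)).aemeasurable (hQm.pow_const _).aemeasurable
  have hleft : ∫⁻ s, g s = ∫⁻ s, ((fun s => g s * Q s ^ (γ / p)) * fun s => Q s ^ (-(γ / p))) s := by
    refine lintegral_congr_ae ?_
    filter_upwards [hQ0] with s hs
    rw [Pi.mul_apply, mul_assoc, ← ENNReal.rpow_add _ _ hs (hQtop s)]
    simp
  rw [← hleft] at hholder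
  have h1 : ∀ s, (g s * Q s ^ (γ / p)) ^ p = g s ^ p * Q s ^ γ := by
    intro s
    rw [ENNReal.mul_rpow_of_nonneg _ _ hp0.le, ← ENNReal.rpow_mul, div_mul_cancel₀ _ hp0.ne',
      ENNReal.rpow_natCast]
  have h2 : ∀ s, (Q s ^ (-(γ / p))) ^ (p / (p - 1)) = Q s ^ (-(((n : ℝ) + 1) / d)) := by
    intro s
    rw [← ENNReal.rpow_mul]
    congr 1
    rw [hp1]
    field_simp
  simp only [h1, h2] at hholder
  have h3 : (∫⁻ s, g s) ^ p ≤ (D * C ^ (p - 1)) *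
      ∏ α ∈ multiIndices n d, ENNReal.ofReal (a α) ^ (1 / D : ℝ) := by
    refine (ENNReal.rpow_le_rpow hholder hp0.le).trans ?_
    rw [ENNReal.mul_rpow_of_nonneg _ _ hp0.le, ← ENNReal.rpow_mul, ← ENNReal.rpow_mul,
      one_div_mul_cancel hp0.ne', ENNReal.rpow_one, mul_assoc,
      show 1 / (p / (p - 1)) * p = p - 1 by field_simp]
    refine mul_le_mul' hgQ ((ENNReal.rpow_le_rpow hkey' hp1'.le).trans_eq ?_)
    rw [ENNReal.mul_rpow_of_nonneg _ _ hp1'.le, ← ENNReal.prod_rpow_of_nonneg hp1'.le]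
    congr 1
    refine Finset.prod_congr rfl fun α _ => ?_
    rw [← ENNReal.rpow_mul]
    congr 1
    rw [hp1]
    field_simp
  calc (∫⁻ s, g s) ^ (D * p) = ((∫⁻ s, g s) ^ p) ^ D := by
        rw [mul_comm, ENNReal.rpow_mul, ENNReal.rpow_natCast]
    _ ≤ _ := pow_le_pow_left' h3 D
    _ = _ := by
        rw [mul_pow, ← Finset.prod_pow]
        congr 1
        refine Finset.prod_congr rfl fun α _ => ?_
        rw [← ENNReal.rpow_natCast, ← ENNReal.rpow_mul, one_div_mul_cancel hD0.ne',
          ENNReal.rpow_one]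

/-- Near-minimisers of the moment problems are the rows of a unitriangular family, so
`lintegral_rpow_le_of_rowMax` bounds the left side by the product of the minima, which the
determinant integral dominates. Finite moments make these minima finite. -/
theorem lintegral_rpow_le_of_finite_moments {n d γ : ℕ} (hd : 1 ≤ d) (hγ : 1 ≤ γ) {p : ℝ}
    (hp : p = 1 + (γ * d : ℝ) / (n + 1)) {e : ℕ → (Fin n → ℕ)}
    (he : multiIndices n d = (Finset.range (multiIndices n d).card).image e)
    (hlex : ∀ i j, i < j → j < (multiIndices n d).card → toLex (e i) < toLex (e j)) :
    ∃ C : ENNReal, C ≠ ⊤ ∧ ∀ g : (Fin n → ℝ) → ENNReal, Measurable g →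
    (∀ j, ∫⁻ s, ‖monomialFun (e j) s‖ₑ ^ γ * g s ^ p ≠ ⊤) →
    (∫⁻ s, g s) ^ ((multiIndices n d).card * p) ≤
      C * ∫⁻ s : Fin (multiIndices n d).card → (Fin n → ℝ),
        ‖(Matrix.of fun i j : Fin (multiIndices n d).card => monomialFun (e j) (s i)).det‖ₑ ^ γ *
          ∏ i, g (s i) ^ p := by
  classical
  obtain ⟨C, hC, hmain⟩ := lintegral_rpow_le_of_rowMax (n := n) hd hγ hp
  refine ⟨C, hC, fun g hg hfin => ?_⟩
  set D := (multiIndices n d).card with hD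
  set m : ℕ → ENNReal := fun j => ⨅ c : ℕ → ℝ, ∫⁻ s,
    ‖monomialFun (e j) s + ∑ k ∈ Finset.range j, c k * monomialFun (e k) s‖ₑ ^ γ * g s ^ p with hm
  have hmtop : ∀ j, m j ≠ ⊤ := fun j =>
    ne_top_of_le_ne_top (hfin j) ((iInf_le _ 0).trans_eq (by simp))
  have hinj : Set.InjOn e (Set.Iio D) := by
    intro i hi j hj hij
    rcases lt_trichotomy i j with h | h | h
    · exact absurd (hlex i j h hj) (by rw [hij]; exact lt_irrefl _)
    · exact h
    · exact absurd (hlex j i h hi) (by rw [hij]; exact lt_irrefl _)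
  have hinj' : Set.InjOn e (Finset.range D : Finset ℕ) := by
    rw [Finset.coe_range]; exact hinj
  set idx : (Fin n → ℕ) → ℕ := Function.invFunOn e (Set.Iio D)
  have hidx : ∀ k < D, idx (e k) = k := fun k hk => hinj.leftInvOn_invFunOn hk
  -- The slack ε is needed because an infimum may be zero or not attained; it is sent to 0 at the
  -- end.
  have hε : ∀ ε : ℝ, 0 < ε → (∫⁻ s, g s) ^ (D * p) ≤
      C * ENNReal.ofReal (∏ k ∈ Finset.range D, ((m k).toReal + ε)) := by
    intro ε hε
    have hw : ∀ j, ∃ w : ℕ → ℝ, ∫⁻ s, ‖monomialFun (e j) s +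
        ∑ k ∈ Finset.range j, w k * monomialFun (e k) s‖ₑ ^ γ * g s ^ p ≤
          ENNReal.ofReal ((m j).toReal + ε) := by
      intro j
      have h1 : m j < ENNReal.ofReal ((m j).toReal + ε) := by
        rw [ENNReal.ofReal_add ENNReal.toReal_nonneg hε.le, ENNReal.ofReal_toReal (hmtop j)]
        exact ENNReal.lt_add_right (hmtop j) (by simpa using hε)
      obtain ⟨w, hw⟩ := iInf_lt_iff.1 h1
      exact ⟨w, hw.le⟩
    choose w hw using hw
    set c : (Fin n → ℕ) → (Fin n → ℕ) → ℝ := fun α β =>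
      if α = β then 1 else if toLex β < toLex α then w (idx α) (idx β) else 0 with hc
    have hcu : IsUnitriangular c := by
      refine ⟨fun α => by simp [hc], fun α β h => ?_⟩
      have h1 : α ≠ β := by
        rintro rfl
        exact lt_irrefl _ h
      simp only [hc]
      rw [if_neg h1]
      exact if_neg (lt_asymm h)
    have hrow : ∀ j < D, ∀ s, rowPoly n d c (e j) s = monomialFun (e j) s +
        ∑ k ∈ Finset.range j, w j k * monomialFun (e k) s := by
      intro j hj s
      have h1 : rowPoly n d c (e j) s =
          ∑ k ∈ Finset.range D, c (e j) (e k) * monomialFun (e k) s := by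
        rw [rowPoly, he, Finset.sum_image hinj']
        rfl
      have h2 : ∑ k ∈ Finset.range (j + 1), c (e j) (e k) * monomialFun (e k) s =
          ∑ k ∈ Finset.range D, c (e j) (e k) * monomialFun (e k) s := by
        refine Finset.sum_subset (Finset.range_subset_range.2 hj) fun k hk hk' => ?_
        have hk1 : k < D := by simpa using hk
        have hk2 : j < k := by simpa using hk'
        rw [hcu.eq_zero _ _ (hlex j k hk2 hk1), zero_mul]
      rw [h1, ← h2, Finset.sum_range_succ, hcu.diag, one_mul, add_comm]
      congr 1
      refine Finset.sum_congr rfl fun k hk => ?_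
      have hk' : k < j := by simpa using hk
      have h3 := hlex k j hk' hj
      have h4 : e j ≠ e k := fun h => by rw [h] at h3; exact lt_irrefl _ h3
      simp only [hc, h4, h3, if_true, if_false, hidx j hj, hidx k (hk'.trans hj)]
    have h5 := hmain g hg (fun α => (m (idx α)).toReal + ε) c (fun α => by positivity) hcu ?_
    · rw [ENNReal.ofReal_prod_of_nonneg fun k _ => by positivity]
      refine h5.trans_eq ?_
      congr 1
      conv_lhs => rw [he]
      rw [Finset.prod_image hinj']
      refine Finset.prod_congr rfl fun k hk => ?_
      rw [hidx k (by simpa using hk)]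
    · intro α hα
      rw [he, Finset.mem_image] at hα
      obtain ⟨j, hj, rfl⟩ := hα
      have hj' : j < D := by simpa using hj
      simp only [hrow j hj', hidx j hj']
      exact hw j
  have hlim : Filter.Tendsto (fun ε : ℝ => C * ENNReal.ofReal
      (∏ k ∈ Finset.range D, ((m k).toReal + ε))) (nhdsWithin 0 (Set.Ioi 0))
      (nhds (C * ∏ k ∈ Finset.range D, m k)) := by
    refine ENNReal.Tendsto.const_mul ?_ (Or.inr hC)
    have hcont : Continuous fun ε : ℝ => ENNReal.ofReal
        (∏ k ∈ Finset.range D, ((m k).toReal + ε)) :=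
        ENNReal.continuous_ofReal.comp (by fun_prop)
    have h6 := (hcont.tendsto 0).mono_left (nhdsWithin_le_nhds (s := Set.Ioi 0))
    simp only [add_zero] at h6
    rw [ENNReal.ofReal_prod_of_nonneg fun k _ => ENNReal.toReal_nonneg] at h6
    simpa only [ENNReal.ofReal_toReal (hmtop _)] using h6
  refine (ge_of_tendsto hlim ?_).trans ?_
  · filter_upwards [self_mem_nhdsWithin] with ε h using hε ε h
  · gcongr
    exact prod_iInf_le_lintegral_enorm_det volume (by omega)
      (fun k => (continuous_monomialFun (e k)).measurable) (hg.pow_const p) D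

/-- Truncating g in height and to balls makes all moments finite with the same constant; monotone
convergence removes the truncation. -/
theorem lintegral_rpow_le_lintegral_enorm_det {n d γ : ℕ} (hd : 1 ≤ d) (hγ : 1 ≤ γ) {p : ℝ}
    (hp : p = 1 + (γ * d : ℝ) / (n + 1)) {e : ℕ → (Fin n → ℕ)}
    (he : multiIndices n d = (Finset.range (multiIndices n d).card).image e)
    (hlex : ∀ i j, i < j → j < (multiIndices n d).card → toLex (e i) < toLex (e j)) :
    ∃ C : ENNReal, C ≠ ⊤ ∧ ∀ g : (Fin n → ℝ) → ENNReal, Measurable g →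
    (∫⁻ s, g s) ^ ((multiIndices n d).card * p) ≤
      C * ∫⁻ s : Fin (multiIndices n d).card → (Fin n → ℝ),
        ‖(Matrix.of fun i j : Fin (multiIndices n d).card => monomialFun (e j) (s i)).det‖ₑ ^ γ *
          ∏ i, g (s i) ^ p := by
  obtain ⟨C, hC, hmain⟩ := lintegral_rpow_le_of_finite_moments hd hγ hp he hlex
  have hp0 : 0 < p := by rw [hp]; positivity
  have hq0 : 0 < ((multiIndices n d).card : ℝ) * p :=
    mul_pos (Nat.cast_pos.2 (Finset.card_pos.2 ⟨0, zero_mem_multiIndices n d⟩)) hp0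
  refine ⟨C, hC, fun g hg => ?_⟩
  set G : ℕ → (Fin n → ℝ) → ENNReal := fun k =>
    (Metric.closedBall (0 : Fin n → ℝ) k).indicator fun s => min (g s) k with hG
  have hGm : ∀ k, Measurable (G k) := fun k =>
    (hg.min measurable_const).indicator Metric.isClosed_closedBall.measurableSet
  have hGle : ∀ k s, G k s ≤ g s := fun k s =>
    (Set.indicator_le_self _ _ _).trans (min_le_left _ _)
  have hGmono : Monotone G := by
    intro k l hkl s
    simp only [hG]
    have hkl' : (k : ℝ) ≤ l := by exact_mod_cast hkl
    refine (Set.indicator_le_indicator_of_subset (Metric.closedBall_subset_closedBall hkl')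
      (fun _ => zero_le) s).trans (Set.indicator_le_indicator ?_)
    exact min_le_min_left _ (by exact_mod_cast hkl)
  have hGsup : ∀ s, ⨆ k, G k s = g s := by
    intro s
    refine le_antisymm (iSup_le fun k => hGle k s) ?_
    have hlim : Filter.Tendsto (fun k : ℕ => min (g s) (k : ENNReal)) Filter.atTop
        (nhds (min (g s) ⊤)) := tendsto_const_nhds.min ENNReal.tendsto_nat_nhds_top
    rw [min_top_right] at hlim
    refine le_of_tendsto hlim ?_
    obtain ⟨K, hK⟩ := exists_nat_ge ‖s‖
    filter_upwards [Filter.eventually_ge_atTop K] with k hk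
    refine le_trans (le_of_eq ?_) (le_iSup (fun k => G k s) k)
    simp only [hG]
    rw [Set.indicator_of_mem]
    rw [mem_closedBall_zero_iff]
    exact hK.trans (by exact_mod_cast hk)
  have hGfin : ∀ k j, ∫⁻ s, ‖monomialFun (e j) s‖ₑ ^ γ * G k s ^ p ≠ ⊤ := by
    intro k j
    obtain ⟨B, hB⟩ := (isCompact_closedBall (0 : Fin n → ℝ) k).exists_bound_of_continuousOn
      (continuous_monomialFun (e j)).continuousOn
    have h1 : ∀ s, ‖monomialFun (e j) s‖ₑ ^ γ * G k s ^ p ≤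
        (Metric.closedBall (0 : Fin n → ℝ) k).indicator
          (fun _ => ENNReal.ofReal B ^ γ * (k : ENNReal) ^ p) s := by
      intro s
      by_cases hs : s ∈ Metric.closedBall (0 : Fin n → ℝ) k
      · simp only [hG, Set.indicator_of_mem hs]
        gcongr
        · rw [← ofReal_norm]
          exact ENNReal.ofReal_le_ofReal (hB s hs)
        · exact min_le_right _ _
      · simp [hG, Set.indicator_of_notMem hs, hp0]
    refine ne_top_of_le_ne_top ?_ (lintegral_mono h1)
    rw [lintegral_indicator_const Metric.isClosed_closedBall.measurableSet]
    refine ENNReal.mul_ne_top (ENNReal.mul_ne_top (ENNReal.pow_ne_top ENNReal.ofReal_ne_top)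
      (ENNReal.rpow_ne_top_of_nonneg hp0.le (by simp))) ?_
    exact (isCompact_closedBall (0 : Fin n → ℝ) k).measure_lt_top.ne
  have hsup : ∫⁻ s, g s = ⨆ k, ∫⁻ s, G k s := by
    rw [← lintegral_iSup hGm hGmono]
    exact lintegral_congr fun s => (hGsup s).symm
  rw [hsup, ← ENNReal.le_rpow_inv_iff hq0]
  refine iSup_le fun k => ?_
  rw [ENNReal.le_rpow_inv_iff hq0]
  refine (hmain (G k) (hGm k) (hGfin k)).trans ?_
  gcongr
  exact hGle k _

/-! ### Averaging over polynomial tuples by a linear change of variables. -/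

/-- Stated as an inequality so that singular maps are included: there the left side is 0. -/
theorem lintegral_enorm_det_mul_le {E : Type*} [NormedAddCommGroup E] [NormedSpace ℝ E]
    [MeasurableSpace E] [BorelSpace E] [FiniteDimensional ℝ E] (μ : Measure E)
    [μ.IsAddHaarMeasure] (L : E →ₗ[ℝ] E) {h : E → ENNReal} (hh : Measurable h) :
    ‖LinearMap.det L‖ₑ * ∫⁻ x, h (L x) ∂μ ≤ ∫⁻ x, h x ∂μ := by
  rcases eq_or_ne (LinearMap.det L) 0 with h0 | h0
  · simp [h0]
  · have hL : Measurable L := L.continuous_of_finiteDimensional.measurable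
    rw [← lintegral_map hh hL, Measure.map_linearMap_addHaar_eq_smul_addHaar μ h0,
      lintegral_smul_measure, smul_eq_mul, ← mul_assoc, Real.enorm_eq_ofReal_abs,
      ← ENNReal.ofReal_mul (abs_nonneg _), ← abs_mul, mul_inv_cancel₀ h0]
    simp

/-- Multiplication by `A` of a family of vectors. -/
def matrixAction {N m : ℕ} (A : Matrix (Fin N) (Fin N) ℝ) :
    (Fin N → Fin m → ℝ) →ₗ[ℝ] (Fin N → Fin m → ℝ) where
  toFun r i j := ∑ k, A i k * r k j
  map_add' r r' := by
    ext i j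
    simp [mul_add, Finset.sum_add_distrib]
  map_smul' c r := by
    ext i j
    simp only [Pi.smul_apply, smul_eq_mul, RingHom.id_apply, Finset.mul_sum]
    exact Finset.sum_congr rfl fun k _ => by ring

theorem det_matrixAction {N m : ℕ} (A : Matrix (Fin N) (Fin N) ℝ) :
    LinearMap.det (matrixAction (m := m) A) = A.det ^ m := by
  let swap : (Fin m → Fin N → ℝ) ≃ₗ[ℝ] (Fin N → Fin m → ℝ) :=
    { toFun := fun r i j => r j i
      invFun := fun r i j => r j i
      map_add' := fun _ _ => rfl
      map_smul' := fun _ _ => rfl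
      left_inv := fun _ => rfl
      right_inv := fun _ => rfl }
  have h1 : matrixAction (m := m) A = (swap : (Fin m → Fin N → ℝ) →ₗ[ℝ] (Fin N → Fin m → ℝ)) ∘ₗ
      (LinearMap.pi fun j => (Matrix.toLin' A).comp (LinearMap.proj j)) ∘ₗ
      (swap.symm : (Fin N → Fin m → ℝ) →ₗ[ℝ] (Fin m → Fin N → ℝ)) := by
    ext r i j
    rfl
  rw [h1, LinearMap.det_conj, LinearMap.det_pi]
  simp [LinearMap.det_toLin']

theorem lintegral_fin_prod {X : Type*} [MeasurableSpace X] (μ : Measure X) [SigmaFinite μ] (N : ℕ)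
    (f : ℕ → X → ENNReal) (hf : ∀ i, Measurable (f i)) :
    ∫⁻ s : Fin N → X, ∏ i : Fin N, f i (s i) ∂(Measure.pi fun _ => μ) =
      ∏ i : Fin N, ∫⁻ x, f i x ∂μ := by
  have hm : ∀ N : ℕ, Measurable fun s : Fin N → X => ∏ i : Fin N, f i (s i) := fun N =>
    Finset.measurable_prod _ fun i _ => (hf i).comp (measurable_pi_apply i)
  induction N with
  | zero => simp
  | succ N ih =>
    rw [lintegral_fin_snoc μ (hm (N + 1)), Fin.prod_univ_castSucc]
    simp only [Fin.prod_univ_castSucc, Fin.snoc_castSucc, Fin.snoc_last, Fin.val_castSucc,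
      Fin.val_last]
    rw [← ih, ← lintegral_mul_const _ (hm N)]
    exact lintegral_congr fun s => lintegral_const_mul _ (hf N)

theorem measurable_polyMap_uncurry {n n' d : ℕ} :
    Measurable fun x : PolyTuple n n' d × (Fin n → ℝ) => polyMap x.1 x.2 := by
  unfold polyMap
  fun_prop

/-- In the coordinates given by the enumeration, evaluating a tuple at the points `s i` is
multiplication by their monomial matrix. -/
theorem lintegral_polyMap_comp {n n' d : ℕ} {e : ℕ → (Fin n → ℕ)}
    (he : multiIndices n d = (Finset.range (multiIndices n d).card).image e)
    (hinj : Set.InjOn e (Finset.range (multiIndices n d).card : Finset ℕ))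
    (s : Fin (multiIndices n d).card → (Fin n → ℝ))
    (H : (Fin (multiIndices n d).card → Fin n' → ℝ) → ENNReal) :
    ∫⁻ r : PolyTuple n n' d, H (fun i => polyMap r (s i)) =
      ∫⁻ r, H (matrixAction (Matrix.of fun i j => monomialFun (e j) (s i)) r) := by
  set D := (multiIndices n d).card with hD
  have hmem : ∀ k : Fin D, e k ∈ multiIndices n d := fun k => by
    rw [he, Finset.mem_image]
    exact ⟨k, by simp, rfl⟩
  have hbij : Function.Bijective fun k : Fin D => (⟨e k, hmem k⟩ : multiIndices n d) := by
    constructor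
    · intro i j hij
      exact Fin.ext (hinj (by simp) (by simp) (congrArg Subtype.val hij))
    · rintro ⟨α, hα⟩
      rw [he, Finset.mem_image] at hα
      obtain ⟨k, hk, rfl⟩ := hα
      exact ⟨⟨k, by simpa using hk⟩, rfl⟩
  set φ : Fin D ≃ multiIndices n d := Equiv.ofBijective _ hbij
  have hmp := volume_measurePreserving_piCongrLeft (fun _ : multiIndices n d => Fin n' → ℝ) φ
  rw [← hmp.lintegral_comp_emb (MeasurableEquiv.measurableEmbedding _)]
  refine lintegral_congr fun r => ?_
  congr 1
  ext i j
  simp only [polyMap, matrixAction, LinearMap.coe_mk, AddHom.coe_mk, Matrix.of_apply]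
  rw [← φ.sum_comp]
  refine Finset.sum_congr rfl fun k _ => ?_
  rw [MeasurableEquiv.coe_piCongrLeft, Equiv.piCongrLeft_apply_apply, mul_comm]
  rfl

theorem lintegral_polyTuple_rpow_le {n n' d : ℕ} (hd : 1 ≤ d) (hn' : 1 ≤ n') {p : ℝ}
    (hp : p = 1 + (n' * d : ℝ) / (n + 1)) : ∃ C : ENNReal, C ≠ ⊤ ∧
    ∀ φ : (Fin n → ℝ) × (Fin n' → ℝ) → ENNReal, Measurable φ →
    ∫⁻ r : PolyTuple n n' d,
        (∫⁻ s, φ (s, polyMap r s)) ^ ((multiIndices n d).card * p) ≤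
      C * (∫⁻ z, φ z ^ p) ^ (multiIndices n d).card := by
  obtain ⟨e, he, hlex⟩ := exists_lex_enumeration n d
  obtain ⟨C, hC, hmain⟩ := lintegral_rpow_le_lintegral_enorm_det (n := n) hd hn' hp he hlex
  refine ⟨C, hC, fun φ hφ => ?_⟩
  have hinj : Set.InjOn e (Finset.range (multiIndices n d).card : Finset ℕ) := by
    rw [Finset.coe_range]
    intro i hi j hj hij
    rcases lt_trichotomy i j with h | h | h
    · exact absurd (hlex i j h hj) (by rw [hij]; exact lt_irrefl _)
    · exact h
    · exact absurd (hlex j i h hi) (by rw [hij]; exact lt_irrefl _)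
  set D := (multiIndices n d).card with hD
  set V : (Fin D → (Fin n → ℝ)) → Matrix (Fin D) (Fin D) ℝ := fun s =>
    Matrix.of fun i j => monomialFun (e j) (s i) with hV
  have hVm : Measurable fun s => ‖(V s).det‖ₑ ^ n' := by
    refine Measurable.pow_const (Measurable.enorm ?_) _
    simp only [Matrix.det_apply, hV, Matrix.of_apply]
    refine Finset.measurable_sum _ fun σ _ => Measurable.const_smul
      (Finset.measurable_prod _ fun i _ =>
        (continuous_monomialFun _).measurable.comp (measurable_pi_apply _)) _
  have hφp : Measurable fun z => φ z ^ p := hφ.pow_const p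
  have hprod : ∀ s : Fin D → (Fin n → ℝ), Measurable fun Y : Fin D → Fin n' → ℝ =>
      ∏ i, φ (s i, Y i) ^ p := fun s =>
    Finset.measurable_prod _ fun i _ =>
      hφp.comp (measurable_const.prodMk (measurable_pi_apply i))
  have hpoly : ∀ i : Fin D, Measurable fun x : PolyTuple n n' d × (Fin D → (Fin n → ℝ)) =>
      polyMap x.1 (x.2 i) := fun i =>
    measurable_polyMap_uncurry.comp
      (measurable_fst.prodMk ((measurable_pi_apply i).comp measurable_snd))
  have hjoint : Measurable (Function.uncurry fun (r : PolyTuple n n' d)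
      (s : Fin D → (Fin n → ℝ)) => ‖(V s).det‖ₑ ^ n' * ∏ i, φ (s i, polyMap r (s i)) ^ p) := by
    refine (hVm.comp measurable_snd).mul (Finset.measurable_prod _ fun i _ => hφp.comp ?_)
    exact ((measurable_pi_apply i).comp measurable_snd).prodMk (hpoly i)
  calc ∫⁻ r : PolyTuple n n' d, (∫⁻ s, φ (s, polyMap r s)) ^ (D * p)
      ≤ ∫⁻ r : PolyTuple n n' d, C * ∫⁻ s : Fin D → (Fin n → ℝ),
          ‖(V s).det‖ₑ ^ n' * ∏ i, φ (s i, polyMap r (s i)) ^ p :=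
        lintegral_mono fun r => hmain (fun s => φ (s, polyMap r s))
          (hφ.comp (measurable_id.prodMk (measurable_polyMap r)))
    _ = C * ∫⁻ s : Fin D → (Fin n → ℝ), ∫⁻ r : PolyTuple n n' d,
          ‖(V s).det‖ₑ ^ n' * ∏ i, φ (s i, polyMap r (s i)) ^ p := by
        rw [lintegral_const_mul' _ _ hC, lintegral_lintegral_swap hjoint.aemeasurable]
    -- For fixed points the weight |det V|^n' is the Jacobian of the evaluation map, so the values
    -- at the points become independent integration variables.
    _ ≤ C * ∫⁻ s : Fin D → (Fin n → ℝ), ∏ i, ∫⁻ y, φ (s i, y) ^ p := by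
        gcongr with s
        rw [lintegral_const_mul' _ _ (ENNReal.pow_ne_top enorm_ne_top),
          lintegral_polyMap_comp he hinj s fun Y => ∏ i, φ (s i, Y i) ^ p]
        have h1 := lintegral_enorm_det_mul_le volume (matrixAction (m := n') (V s)) (hprod s)
        rw [det_matrixAction, enorm_pow] at h1
        refine h1.trans_eq ?_
        have h2 := lintegral_fin_prod (volume : Measure (Fin n' → ℝ)) D
          (fun i y => if hi : i < D then φ (s ⟨i, hi⟩, y) ^ p else 0) (fun i => by
            by_cases hi : i < D
            · simp only [hi, dif_pos]
              exact hφp.comp (measurable_const.prodMk measurable_id)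
            · simp [hi])
        simp only [Fin.is_lt, dif_pos, Fin.eta] at h2
        exact h2
    _ = C * (∫⁻ z, φ z ^ p) ^ D := by
        rw [Measure.volume_eq_prod, lintegral_prod _ hφp.aemeasurable]
        have h3 := lintegral_fin_prod (volume : Measure (Fin n → ℝ)) D
          (fun _ x => ∫⁻ y, φ (x, y) ^ p) (fun _ => hφp.lintegral_prod_right')
        rw [volume_pi, h3]
        simp

/-! ### The reflections of coefficient space. -/

/-- The coefficient of `s ^ α` in `(x - s) ^ β`. -/
def reflectCoeff {n : ℕ} (x : Fin n → ℝ) (β α : Fin n → ℕ) : ℝ :=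
  ∏ i, ((β i).choose (α i) * (-1) ^ α i * x i ^ (β i - α i))

theorem reflectCoeff_eq_zero {n : ℕ} (x : Fin n → ℝ) {β α : Fin n → ℕ} (h : ¬ α ≤ β) :
    reflectCoeff x β α = 0 := by
  rw [Pi.le_def] at h
  push Not at h
  obtain ⟨i, hi⟩ := h
  exact Finset.prod_eq_zero (Finset.mem_univ i) (by simp [Nat.choose_eq_zero_of_lt hi])

theorem prod_sub_pow_eq_sum {n d : ℕ} {β : Fin n → ℕ} (hβ : β ∈ multiIndices n d)
    (x s : Fin n → ℝ) : ∏ i, (x i - s i) ^ β i =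
      ∑ α : multiIndices n d, reflectCoeff x β α * ∏ i, s i ^ (α : Fin n → ℕ) i := by
  rw [mem_multiIndices] at hβ
  have h1 : ∀ i, (x i - s i) ^ β i = ∑ a ∈ Finset.range (d + 1),
      (β i).choose a * (-1) ^ a * x i ^ (β i - a) * s i ^ a := by
    intro i
    have hi : β i ≤ d := (Finset.single_le_sum (f := β) (fun _ _ => Nat.zero_le _)
      (Finset.mem_univ i)).trans hβ
    rw [sub_eq_neg_add, add_pow]
    refine (Finset.sum_subset (Finset.range_subset_range.2 (Nat.succ_le_succ hi)) ?_).trans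
      (Finset.sum_congr rfl fun a _ => ?_)
    · intro a _ ha
      have : β i < a := by simpa using ha
      simp [Nat.choose_eq_zero_of_lt this]
    · rw [neg_pow]; ring
  simp only [h1]
  rw [Finset.prod_univ_sum, Finset.sum_coe_sort (multiIndices n d)
    (fun α => reflectCoeff x β α * ∏ i, s i ^ α i)]
  have h2 : ∀ α : Fin n → ℕ, ∏ i, ((β i).choose (α i) * (-1) ^ α i * x i ^ (β i - α i) *
      s i ^ α i) = reflectCoeff x β α * ∏ i, s i ^ α i := fun α => by
    rw [Finset.prod_mul_distrib, reflectCoeff]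
  simp only [h2]
  symm
  refine Finset.sum_subset (Finset.filter_subset _ _) fun α _ hα => ?_
  rw [reflectCoeff_eq_zero, zero_mul]
  intro hle
  exact hα ((mem_multiIndices α).2 ((Finset.sum_le_sum fun i _ => hle i).trans hβ))

/-- Lets the involution identities be checked on polynomial functions instead of on binomial
coefficients. -/
theorem polyMap_injective {n n' d : ℕ} :
    Function.Injective (polyMap : PolyTuple n n' d → (Fin n → ℝ) → Fin n' → ℝ) := by
  intro r r' h
  ext α j
  set P : PolyTuple n n' d → MvPolynomial (Fin n) ℝ := fun r =>
    ∑ β : multiIndices n d, MvPolynomial.monomial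
      (Finsupp.equivFunOnFinite.symm (β : Fin n → ℕ)) (r β j) with hP
  have heval : ∀ (r : PolyTuple n n' d) (s : Fin n → ℝ),
      MvPolynomial.eval s (P r) = polyMap r s j := by
    intro r s
    simp [hP, polyMap, MvPolynomial.eval_monomial, Finsupp.prod_fintype]
  have hcoeff : ∀ r : PolyTuple n n' d,
      (P r).coeff (Finsupp.equivFunOnFinite.symm (α : Fin n → ℕ)) = r α j := by
    intro r
    simp only [hP, MvPolynomial.coeff_sum, MvPolynomial.coeff_monomial, EmbeddingLike.apply_eq_iff_eq,
      Subtype.coe_inj]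
    simp
  rw [← hcoeff r, ← hcoeff r']
  congr 1
  refine MvPolynomial.funext fun s => ?_
  rw [heval, heval, h]

/-- The linear map taking `r` to `s ↦ r (x - s)`. -/
def reflectLinear {n n' d : ℕ} (x : Fin n → ℝ) : PolyTuple n n' d →ₗ[ℝ] PolyTuple n n' d where
  toFun r α j := ∑ β, r β j * reflectCoeff x β α
  map_add' r r' := by
    ext α j
    simp [add_mul, Finset.sum_add_distrib]
  map_smul' c r := by
    ext α j
    simp [Finset.mul_sum, mul_assoc]

theorem reflectLinear_apply {n n' d : ℕ} (x : Fin n → ℝ) (r : PolyTuple n n' d)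
    (α : multiIndices n d) (j : Fin n') :
    reflectLinear x r α j = ∑ β, r β j * reflectCoeff x β α := rfl

theorem polyMap_reflectLinear {n n' d : ℕ} (x : Fin n → ℝ) (r : PolyTuple n n' d)
    (s : Fin n → ℝ) : polyMap (reflectLinear x r) s = polyMap r (x - s) := by
  ext j
  simp only [polyMap, reflectLinear_apply, Finset.sum_mul, Pi.sub_apply]
  rw [Finset.sum_comm]
  refine Finset.sum_congr rfl fun β _ => ?_
  rw [prod_sub_pow_eq_sum β.2, Finset.mul_sum]
  exact Finset.sum_congr rfl fun α _ => by ring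

theorem reflectLinear_reflectLinear {n n' d : ℕ} (x : Fin n → ℝ) (r : PolyTuple n n' d) :
    reflectLinear x (reflectLinear x r) = r := by
  refine polyMap_injective (funext fun s => ?_)
  rw [polyMap_reflectLinear, polyMap_reflectLinear, sub_sub_cancel]

/-- The map is an involution, so its determinant is ±1. -/
theorem enorm_det_reflectLinear {n n' d : ℕ} (x : Fin n → ℝ) :
    ‖LinearMap.det (reflectLinear (n' := n') (d := d) x)‖ₑ = 1 := by
  have h1 : reflectLinear (n' := n') (d := d) x ∘ₗ reflectLinear x = LinearMap.id :=
    LinearMap.ext fun r => reflectLinear_reflectLinear x r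
  have h2 := congrArg LinearMap.det h1
  rw [LinearMap.det_comp, LinearMap.det_id, mul_self_eq_one_iff] at h2
  rcases h2 with h | h <;> simp [h]

/-- The coefficients of the constant polynomial tuple `y`. -/
def constTuple {n n' d : ℕ} (y : Fin n' → ℝ) : PolyTuple n n' d :=
  fun α j => if (α : Fin n → ℕ) = 0 then y j else 0

theorem polyMap_constTuple {n n' d : ℕ} (y : Fin n' → ℝ) (s : Fin n → ℝ) :
    polyMap (constTuple y : PolyTuple n n' d) s = y := by
  ext j
  simp only [polyMap, constTuple]
  rw [Finset.sum_eq_single_of_mem ⟨0, zero_mem_multiIndices n d⟩ (Finset.mem_univ _)]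
  · simp
  · intro β _ hβ
    have : (β : Fin n → ℕ) ≠ 0 := fun h => hβ (Subtype.ext h)
    simp [this]

/-- The action of `z = (x, y)` on polynomial tuples taking `r` to `s ↦ y - r (x - s)`. -/
def reflectTuple {n n' d : ℕ} (z : (Fin n → ℝ) × (Fin n' → ℝ)) (r : PolyTuple n n' d) :
    PolyTuple n n' d :=
  constTuple z.2 - reflectLinear z.1 r

theorem polyMap_sub {n n' d : ℕ} (r r' : PolyTuple n n' d) (s : Fin n → ℝ) :
    polyMap (r - r') s = polyMap r s - polyMap r' s := by
  ext j
  simp [polyMap, sub_mul, Finset.sum_sub_distrib]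

theorem polyMap_reflectTuple {n n' d : ℕ} (z : (Fin n → ℝ) × (Fin n' → ℝ))
    (r : PolyTuple n n' d) (s : Fin n → ℝ) :
    polyMap (reflectTuple z r) s = z.2 - polyMap r (z.1 - s) := by
  rw [reflectTuple, polyMap_sub, polyMap_constTuple, polyMap_reflectLinear]

theorem reflectTuple_reflectTuple {n n' d : ℕ} (z : (Fin n → ℝ) × (Fin n' → ℝ))
    (r : PolyTuple n n' d) : reflectTuple z (reflectTuple z r) = r := by
  refine polyMap_injective (funext fun s => ?_)
  rw [polyMap_reflectTuple, polyMap_reflectTuple, sub_sub_cancel, sub_sub_cancel]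

theorem measurable_reflectTuple {n n' d : ℕ} :
    Measurable fun q : ((Fin n → ℝ) × (Fin n' → ℝ)) × PolyTuple n n' d =>
      reflectTuple q.1 q.2 := by
  refine measurable_pi_lambda _ fun α => measurable_pi_lambda _ fun j => ?_
  simp only [reflectTuple, Pi.sub_apply, reflectLinear_apply, constTuple, reflectCoeff]
  refine Measurable.sub ?_ (by fun_prop)
  split_ifs <;> fun_prop

theorem lintegral_reflectTuple_le {n n' d : ℕ} (z : (Fin n → ℝ) × (Fin n' → ℝ))
    {G : PolyTuple n n' d → ENNReal} (hG : Measurable G) :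
    ∫⁻ r, G (reflectTuple z r) ≤ ∫⁻ r, G r := by
  have h1 := lintegral_enorm_det_mul_le volume (reflectLinear (n' := n') (d := d) z.1)
    (h := fun r => G (constTuple z.2 - r)) (hG.comp (measurable_const.sub measurable_id))
  rw [enorm_det_reflectLinear, one_mul, lintegral_sub_left_eq_self G (constTuple z.2)] at h1
  exact h1

/-! ### How reflections move the coefficients of the two highest degrees. -/

theorem sum_single_add_single {n m : ℕ} (i k : Fin n) :
    ∑ l, (Pi.single i m + Pi.single k 1 : Fin n → ℕ) l = m + 1 := by
  simp [Finset.sum_add_distrib]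

/-- The multiindex of the monomial `s i ^ m`. -/
def lowIndex {n : ℕ} (m : ℕ) (i : Fin n) : multiIndices n (m + 1) :=
  ⟨Pi.single i m, (mem_multiIndices _).2 (by simp)⟩

/-- The multiindex of the monomial `s i ^ m * s k`. -/
def topIndex {n : ℕ} (m : ℕ) (i k : Fin n) : multiIndices n (m + 1) :=
  ⟨Pi.single i m + Pi.single k 1, (mem_multiIndices _).2 (sum_single_add_single i k).le⟩

/-- The coefficient with which `s i ^ m * x k` occurs in `(x i + s i) ^ m * (x k + s k)`. -/
def topWeight {n : ℕ} (m : ℕ) (i k : Fin n) : ℝ :=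
  ∏ l, (((topIndex m i k : Fin n → ℕ) l).choose ((lowIndex m i : Fin n → ℕ) l) : ℝ)

theorem topWeight_self {n : ℕ} (m : ℕ) (i : Fin n) : topWeight m i i = m + 1 := by
  rw [topWeight, Finset.prod_eq_single_of_mem i (Finset.mem_univ i)]
  · simp [topIndex, lowIndex]
  · intro l _ hl
    simp [topIndex, lowIndex, hl]

/-- This fails for m = 0, where the first index leaves no trace; it is one place where d ≥ 2 is
needed. -/
theorem topIndex_eq_self_iff {n m : ℕ} (hm : 1 ≤ m) (i k l : Fin n) :
    topIndex m i k = topIndex m l l ↔ i = k ∧ i = l := by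
  constructor
  · intro h
    have h1 := congrArg Subtype.val h
    simp only [topIndex] at h1
    have hi := congrFun h1 i
    have hk := congrFun h1 k
    simp only [Pi.add_apply, Pi.single_apply] at hi hk
    by_cases h2 : i = l
    · by_cases h3 : k = l
      · exact ⟨h2.trans h3.symm, h2⟩
      · simp [h3] at hk
    · exfalso
      simp [h2] at hi
      omega
  · rintro ⟨rfl, rfl⟩
    rfl

theorem reflectCoeff_self {n : ℕ} (x : Fin n → ℝ) (α : Fin n → ℕ) :
    reflectCoeff x α α = (-1) ^ ∑ i, α i := by
  simp [reflectCoeff, Finset.prod_pow_eq_pow_sum]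

theorem reflectCoeff_topIndex_lowIndex {n : ℕ} (m : ℕ) (x : Fin n → ℝ) (i k : Fin n) :
    reflectCoeff x (topIndex m i k) (lowIndex m i) = (-1) ^ m * (topWeight m i k * x k) := by
  rw [reflectCoeff, Finset.prod_mul_distrib, Finset.prod_mul_distrib, ← topWeight,
    Finset.prod_pow_eq_pow_sum]
  have h1 : ∑ l, (lowIndex m i : Fin n → ℕ) l = m := by simp [lowIndex]
  have h2 : ∏ l, x l ^ ((topIndex m i k : Fin n → ℕ) l - (lowIndex m i : Fin n → ℕ) l) = x k := by
    rw [Finset.prod_eq_single_of_mem k (Finset.mem_univ k)]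
    · simp [topIndex, lowIndex]
    · intro l _ hl
      simp [topIndex, lowIndex, hl]
  rw [h1, h2]
  ring

theorem eq_lowIndex_or_topIndex {n m : ℕ} (i : Fin n) (β : multiIndices n (m + 1))
    (h : (lowIndex m i : Fin n → ℕ) ≤ β) : β = lowIndex m i ∨ ∃ k, β = topIndex m i k := by
  obtain ⟨β, hβ⟩ := β
  rw [mem_multiIndices] at hβ
  obtain ⟨δ, rfl⟩ := exists_add_of_le h
  simp only [Pi.add_apply, Finset.sum_add_distrib, lowIndex, Finset.sum_pi_single',
    Finset.mem_univ, if_true] at hβ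
  have hδ : ∑ l, δ l ≤ 1 := by omega
  by_cases h0 : δ = 0
  · left
    subst h0
    simp
  · right
    obtain ⟨k, hk⟩ := Function.ne_iff.1 h0
    refine ⟨k, Subtype.ext ?_⟩
    have hsplit := Finset.add_sum_erase Finset.univ δ (Finset.mem_univ k)
    have hk' : δ k ≠ 0 := hk
    have herase : ∑ l ∈ Finset.univ.erase k, δ l = 0 := by omega
    have : δ = Pi.single k 1 := by
      ext l
      by_cases hl : l = k
      · subst hl
        simp; omega
      · rw [Finset.sum_eq_zero_iff] at herase
        simp [hl, herase l (by simp [hl])]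
    simp only [topIndex, lowIndex, this]

/-- A multiindex of maximal degree is dominated only by itself, so only the diagonal coefficient
survives. -/
theorem reflectLinear_topIndex {n n' m : ℕ} (x : Fin n → ℝ) (r : PolyTuple n n' (m + 1))
    (i k : Fin n) (j : Fin n') :
    reflectLinear x r (topIndex m i k) j = (-1) ^ (m + 1) * r (topIndex m i k) j := by
  have hsum : ∑ l, (topIndex m i k : Fin n → ℕ) l = m + 1 := sum_single_add_single i k
  rw [reflectLinear_apply, Finset.sum_eq_single_of_mem (topIndex m i k) (Finset.mem_univ _)]
  · rw [reflectCoeff_self, hsum, mul_comm]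
  · intro β _ hβ
    rw [reflectCoeff_eq_zero, mul_zero]
    intro hle
    refine hβ (Subtype.ext (funext fun l => ?_))
    have h1 := (mem_multiIndices _).1 β.2
    have h2 := Finset.sum_le_sum fun l (_ : l ∈ Finset.univ) => hle l
    exact (((Finset.sum_eq_sum_iff_of_le fun l _ => hle l).1 (by omega)) l (Finset.mem_univ l)).symm

/-- In degree at most m + 1, only the index itself and its one-step increments dominate an index of
degree m; hence the dependence on `x` is affine. -/
theorem reflectLinear_lowIndex {n n' m : ℕ} (x : Fin n → ℝ) (r : PolyTuple n n' (m + 1))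
    (i : Fin n) (j : Fin n') :
    reflectLinear x r (lowIndex m i) j = (-1) ^ m *
      (r (lowIndex m i) j + ∑ k, topWeight m i k * r (topIndex m i k) j * x k) := by
  have hlow : ∑ l, (lowIndex m i : Fin n → ℕ) l = m := by simp [lowIndex]
  have hinj : Function.Injective fun o : Option (Fin n) =>
      o.elim (lowIndex m i) (topIndex m i) := by
    have hne : ∀ k, lowIndex m i ≠ topIndex m i k := by
      intro k h
      have h1 : ∑ l, (topIndex m i k : Fin n → ℕ) l = m + 1 := sum_single_add_single i k
      rw [← h, hlow] at h1
      omega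
    rintro (_ | k) (_ | k') h
    · rfl
    · exact absurd h (hne k')
    · exact absurd h.symm (hne k)
    · have h1 := add_left_cancel (congrArg Subtype.val h)
      have h2 := congrFun h1 k
      by_contra h3
      have h4 : k ≠ k' := fun h => h3 (congrArg some h)
      simp [h4] at h2
  rw [reflectLinear_apply, ← Fintype.sum_of_injective _ hinj
    (fun o => r (o.elim (lowIndex m i) (topIndex m i)) j *
      reflectCoeff x (o.elim (lowIndex m i) (topIndex m i) : multiIndices n (m + 1)) (lowIndex m i))
    (fun β => r β j * reflectCoeff x β (lowIndex m i)) ?_ fun _ => rfl]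
  · simp only [Fintype.sum_option, Option.elim_none, Option.elim_some, reflectCoeff_self, hlow,
      reflectCoeff_topIndex_lowIndex]
    rw [mul_add, Finset.mul_sum, mul_comm]
    congr 1
    exact Finset.sum_congr rfl fun k _ => by ring
  · intro β hβ
    rw [reflectCoeff_eq_zero, mul_zero]
    intro hle
    rcases eq_lowIndex_or_topIndex i β hle with h | ⟨k, h⟩
    · exact hβ ⟨none, h.symm⟩
    · exact hβ ⟨some k, h.symm⟩

/-- The matrix whose rows are the linear parts in `x` of the coefficients of `s i ^ m` in
`r (x + s)`. -/
def topMatrix {n n' m : ℕ} (j : Fin n') (r : PolyTuple n n' (m + 1)) : Matrix (Fin n) (Fin n) ℝ :=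
  Matrix.of fun i k => topWeight m i k * r (topIndex m i k) j

theorem measurable_det_topMatrix {n n' m : ℕ} (j : Fin n') :
    Measurable fun r : PolyTuple n n' (m + 1) => (topMatrix j r).det := by
  simp only [Matrix.det_apply, topMatrix, Matrix.of_apply]
  fun_prop

theorem constTuple_of_ne {n n' d : ℕ} (y : Fin n' → ℝ) {α : multiIndices n d}
    (hα : (α : Fin n → ℕ) ≠ 0) (j : Fin n') : constTuple y α j = 0 := by
  simp [constTuple, hα]

theorem reflectTuple_lowIndex {n n' m : ℕ} (hm : 1 ≤ m) (z : (Fin n → ℝ) × (Fin n' → ℝ))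
    (r : PolyTuple n n' (m + 1)) (j : Fin n') (i : Fin n) :
    reflectTuple z r (lowIndex m i) j =
      (-1) ^ (m + 1) * (r (lowIndex m i) j + (topMatrix j r).mulVec z.1 i) := by
  have h : (lowIndex m i : Fin n → ℕ) ≠ 0 := by
    intro h
    have := congrFun h i
    simp [lowIndex] at this
    omega
  rw [reflectTuple, Pi.sub_apply, Pi.sub_apply, constTuple_of_ne _ h, reflectLinear_lowIndex]
  simp only [topMatrix, Matrix.mulVec, dotProduct, Matrix.of_apply]
  ring

theorem topMatrix_reflectTuple {n n' m : ℕ} (z : (Fin n → ℝ) × (Fin n' → ℝ))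
    (r : PolyTuple n n' (m + 1)) (j : Fin n') :
    topMatrix j (reflectTuple z r) = (-1 : ℝ) ^ m • topMatrix j r := by
  ext i k
  have h : (topIndex m i k : Fin n → ℕ) ≠ 0 := by
    intro h
    have := congrFun h k
    simp [topIndex] at this
  simp only [topMatrix, Matrix.of_apply, Matrix.smul_apply, smul_eq_mul]
  rw [reflectTuple, Pi.sub_apply, Pi.sub_apply, constTuple_of_ne _ h, reflectLinear_topIndex]
  ring

theorem enorm_det_smul_of_sign {n : ℕ} (m : ℕ) (A : Matrix (Fin n) (Fin n) ℝ) :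
    ‖((-1 : ℝ) ^ m • A).det‖ₑ = ‖A.det‖ₑ := by
  rw [Matrix.det_smul, enorm_mul, enorm_pow, enorm_pow]
  simp

/-- Moving in the direction of the pure powers adds a multiple of the identity, so on each such line
the determinant is a characteristic polynomial, with finitely many zeros. Fubini along these lines
gives the null set. -/
theorem ae_det_topMatrix_ne_zero {n n' m : ℕ} (hm : 1 ≤ m) (j : Fin n') :
    ∀ᵐ r : PolyTuple n n' (m + 1), (topMatrix j r).det ≠ 0 := by
  classical
  set v : PolyTuple n n' (m + 1) := fun α _ => if ∃ l, α = topIndex m l l then 1 else 0 with hv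
  have hmat : ∀ (r : PolyTuple n n' (m + 1)) (t : ℝ),
      topMatrix j (r + t • v) = Matrix.scalar (Fin n) (t * (m + 1)) - -topMatrix j r := by
    intro r t
    ext i k
    simp only [topMatrix, Matrix.of_apply, Matrix.sub_apply, Matrix.neg_apply, Pi.add_apply,
      Pi.smul_apply, smul_eq_mul, hv, topIndex_eq_self_iff hm, Matrix.scalar_apply,
      Matrix.diagonal_apply]
    by_cases hik : i = k
    · subst hik
      simp [topWeight_self]
      ring
    · simp [hik]
  have hS : MeasurableSet {r : PolyTuple n n' (m + 1) | (topMatrix j r).det ≠ 0} :=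
    (measurable_det_topMatrix j) (measurableSet_singleton 0).compl
  refine ae_mem_of_ae_add_linearMap_mem (LinearMap.toSpanSingleton ℝ _ v) volume volume hS
    fun r => ?_
  rw [ae_iff]
  refine Set.Finite.measure_zero (Set.Finite.subset (Set.Finite.preimage (f := fun t : ℝ =>
    t * (m + 1)) ?_ (Polynomial.finite_setOfPred_isRoot (Matrix.charpoly_monic
      (-topMatrix j r)).ne_zero)) ?_) _
  · exact (mul_left_injective₀ (by positivity)).injOn
  · intro t ht
    have h1 : (topMatrix j (r + t • v)).det = 0 := not_not.1 ht
    rw [hmat] at h1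
    simpa [Polynomial.IsRoot, Matrix.eval_charpoly] using h1

/-! ### Integrability along almost every orbit. -/

/-- A positive weight on polynomial tuples whose integral along the orbits of the action of
`reflectTuple` is bounded. -/
noncomputable def orbitWeight {n n' m : ℕ} (j : Fin n') (h : (Fin n → ℝ) → ENNReal)
    (k : (Fin n' → ℝ) → ENNReal) (r : PolyTuple n n' (m + 1)) : ENNReal :=
  ‖(topMatrix j r).det‖ₑ * (h (fun i => r (lowIndex m i) j) * k (polyMap r 0))

theorem measurable_orbitWeight {n n' m : ℕ} (j : Fin n') {h : (Fin n → ℝ) → ENNReal}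
    (hh : Measurable h) {k : (Fin n' → ℝ) → ENNReal} (hk : Measurable k) :
    Measurable (orbitWeight (m := m) j h k) := by
  refine (measurable_det_topMatrix j).enorm.mul ((hh.comp ?_).mul (hk.comp ?_))
  · fun_prop
  · exact measurable_polyMap_uncurry.comp (measurable_id.prodMk measurable_const)

/-- The y-integral only translates `k`. The x-integral sees `h` at ±(b + Mx), and the factor |det
M|, unchanged along the orbit, is the Jacobian of this affine map. -/
theorem lintegral_orbitWeight_le {n n' m : ℕ} (hm : 1 ≤ m) (j : Fin n')
    {h : (Fin n → ℝ) → ENNReal} (hh : Measurable h) {k : (Fin n' → ℝ) → ENNReal}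
    (hk : Measurable k) (r : PolyTuple n n' (m + 1)) :
    ∫⁻ z, orbitWeight j h k (reflectTuple z r) ≤ (∫⁻ x, h x) * ∫⁻ y, k y := by
  have hmeas : Measurable fun z => orbitWeight j h k (reflectTuple z r) :=
    (measurable_orbitWeight j hh hk).comp
      (measurable_reflectTuple.comp (measurable_id.prodMk measurable_const))
  set b : Fin n → ℝ := fun i => r (lowIndex m i) j with hb
  set M := topMatrix j r with hM
  have hw : ∀ x y, orbitWeight j h k (reflectTuple (x, y) r) =
      ‖M.det‖ₑ * h ((-1 : ℝ) ^ (m + 1) • (b + M.mulVec x)) * k (y - polyMap r x) := by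
    intro x y
    rw [orbitWeight, topMatrix_reflectTuple, enorm_det_smul_of_sign, polyMap_reflectTuple,
      sub_zero, ← mul_assoc]
    simp only [reflectTuple_lowIndex hm]
    rfl
  rw [Measure.volume_eq_prod, lintegral_prod _ hmeas.aemeasurable]
  have hinner : ∀ x, ∫⁻ y, orbitWeight j h k (reflectTuple (x, y) r) =
      ‖M.det‖ₑ * h ((-1 : ℝ) ^ (m + 1) • (b + M.mulVec x)) * ∫⁻ y, k y := by
    intro x
    have hkm : Measurable fun y => k (y - polyMap r x) := hk.comp (measurable_id.sub_const _)
    simp only [hw]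
    rw [lintegral_const_mul _ hkm, lintegral_sub_right_eq_self k]
  have hH : Measurable fun u : Fin n → ℝ => h ((-1 : ℝ) ^ (m + 1) • (b + u)) :=
    hh.comp (by fun_prop)
  have hMm : Measurable fun x : Fin n → ℝ => M.mulVec x :=
    (Matrix.toLin' M).continuous_of_finiteDimensional.measurable
  have hHM : Measurable fun x => h ((-1 : ℝ) ^ (m + 1) • (b + M.mulVec x)) := hH.comp hMm
  simp only [hinner]
  rw [lintegral_mul_const _ (hHM.const_mul _), lintegral_const_mul _ hHM]
  gcongr
  have h1 := lintegral_enorm_det_mul_le volume (Matrix.toLin' M) hH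
  rw [LinearMap.det_toLin'] at h1
  refine h1.trans_eq ?_
  rw [lintegral_add_left_eq_self (fun u => h ((-1 : ℝ) ^ (m + 1) • u)) b]
  rcases neg_one_pow_eq_or ℝ (m + 1) with h2 | h2
  · simp [h2]
  · simp only [h2, neg_smul, one_smul]
    exact lintegral_neg_eq_self h

theorem ae_lintegral_reflectTuple_lt_top {n n' m : ℕ} (hm : 1 ≤ m) (j : Fin n')
    {F : PolyTuple n n' (m + 1) → ENNReal} (hF : Measurable F) (hfin : ∫⁻ r, F r ≠ ⊤) :
    ∀ᵐ r, ∫⁻ z, F (reflectTuple z r) < ⊤ := by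
  -- Strict positivity confines the zeros of the weight to the null set det = 0; integrals below 1
  -- bound its orbit integrals by 1.
  obtain ⟨h, hpos, hh, hint⟩ := exists_pos_lintegral_lt_of_sigmaFinite
    (volume : Measure (Fin n → ℝ)) one_ne_zero
  obtain ⟨k, kpos, hk, kint⟩ := exists_pos_lintegral_lt_of_sigmaFinite
    (volume : Measure (Fin n' → ℝ)) one_ne_zero
  set w : PolyTuple n n' (m + 1) → ENNReal :=
    orbitWeight j (fun x => (h x : ENNReal)) (fun y => (k y : ENNReal)) with hw
  have hwm : Measurable w :=
    measurable_orbitWeight j hh.coe_nnreal_ennreal hk.coe_nnreal_ennreal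
  have hτ : Measurable fun q : PolyTuple n n' (m + 1) × ((Fin n → ℝ) × (Fin n' → ℝ)) =>
      reflectTuple q.2 q.1 :=
    measurable_reflectTuple.comp (measurable_snd.prodMk measurable_fst)
  have hτz : ∀ z, Measurable fun r : PolyTuple n n' (m + 1) => reflectTuple z r := fun z =>
    measurable_reflectTuple.comp (measurable_const.prodMk measurable_id)
  have hτr : ∀ r : PolyTuple n n' (m + 1), Measurable fun z => reflectTuple z r := fun r =>
    measurable_reflectTuple.comp (measurable_id.prodMk measurable_const)
  have hbound : ∫⁻ r, w r * ∫⁻ z, F (reflectTuple z r) ≤ ∫⁻ r, F r := by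
    calc ∫⁻ r, w r * ∫⁻ z, F (reflectTuple z r)
        = ∫⁻ r, ∫⁻ z, w r * F (reflectTuple z r) :=
          lintegral_congr fun r => (lintegral_const_mul _ (hF.comp (hτr r))).symm
      _ = ∫⁻ z, ∫⁻ r, w r * F (reflectTuple z r) :=
          lintegral_lintegral_swap
            ((hwm.comp measurable_fst).mul (hF.comp hτ)).aemeasurable
      -- Substituting `reflectTuple z r` for `r` moves the reflection from F to w, since it is its
      -- own inverse.
      _ ≤ ∫⁻ z, ∫⁻ r, w (reflectTuple z r) * F r := by
          refine lintegral_mono fun z => ?_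
          have h1 := lintegral_reflectTuple_le z (G := fun r => w (reflectTuple z r) * F r)
            ((hwm.comp (hτz z)).mul hF)
          simpa only [reflectTuple_reflectTuple] using h1
      _ = ∫⁻ r, ∫⁻ z, w (reflectTuple z r) * F r :=
          (lintegral_lintegral_swap
            ((hwm.comp hτ).mul (hF.comp measurable_fst)).aemeasurable).symm
      _ ≤ ∫⁻ r, 1 * F r := by
          refine lintegral_mono fun r => ?_
          have hwr : Measurable fun z => w (reflectTuple z r) := hwm.comp (hτr r)
          rw [lintegral_mul_const _ hwr]
          refine mul_le_mul_left ((lintegral_orbitWeight_le hm j hh.coe_nnreal_ennreal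
            hk.coe_nnreal_ennreal r).trans ?_) _
          exact (mul_le_mul' hint.le kint.le).trans_eq (one_mul 1)
      _ = _ := by simp
  have hmeas : Measurable fun r => w r * ∫⁻ z, F (reflectTuple z r) :=
    hwm.mul (Measurable.lintegral_prod_right' (f := fun q : PolyTuple n n' (m + 1) ×
      ((Fin n → ℝ) × (Fin n' → ℝ)) => F (reflectTuple q.2 q.1)) (hF.comp hτ))
  filter_upwards [ae_lt_top hmeas (ne_top_of_le_ne_top hfin hbound),
    ae_det_topMatrix_ne_zero hm j] with r hr hdet
  rw [lt_top_iff_ne_top] at hr ⊢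
  intro htop
  rw [htop, ENNReal.mul_top] at hr
  · exact hr rfl
  · simp [hw, orbitWeight, hdet, (hpos _).ne', (kpos _).ne']

/-! ### Transfer to the convolution. -/

instance {n n' d : ℕ} (r : PolyTuple n n' d) : SFinite (graphMeasure r) := by
  unfold graphMeasure
  infer_instance

theorem lintegral_sub_graphMeasure {n n' d : ℕ} (r : PolyTuple n n' d)
    {φ : (Fin n → ℝ) × (Fin n' → ℝ) → ENNReal} (hφ : Measurable φ)
    (z : (Fin n → ℝ) × (Fin n' → ℝ)) :
    ∫⁻ w, φ (z - w) ∂(graphMeasure r) = ∫⁻ s, φ (s, polyMap (reflectTuple z r) s) := by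
  have hsub : Measurable fun w => φ (z - w) := hφ.comp (measurable_id.const_sub z)
  rw [lintegral_graphMeasure r hsub,
    ← lintegral_sub_left_eq_self (fun s => φ (s, polyMap (reflectTuple z r) s)) z.1]
  refine lintegral_congr fun t => ?_
  rw [polyMap_reflectTuple, sub_sub_cancel]
  rfl

/-- Although μ may be singular, subtraction is quasi-measure-preserving from ν × μ to ν. So changing
f on a ν-null set changes f(z - ·) only μ-almost nowhere for almost every z, and a measurable
representative suffices. -/
theorem integrable_and_memLp_convMeasure {G 𝕜 : Type*} [AddGroup G] [MeasurableSpace G]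
    [MeasurableAdd₂ G] [MeasurableNeg G] [RCLike 𝕜] (ν μ : Measure G) [SFinite ν] [SFinite μ]
    [ν.IsAddRightInvariant] {f g : G → 𝕜} (hg : StronglyMeasurable g) (hfg : f =ᵐ[ν] g)
    {q : ℝ} (hq : 0 < q) (hfin : ∫⁻ z, (∫⁻ w, ‖g (z - w)‖ₑ ∂μ) ^ q ∂ν < ⊤) :
    (∀ᵐ z ∂ν, Integrable (fun w => f (z - w)) μ) ∧
      MemLp (convMeasure f μ) (ENNReal.ofReal q) ν := by
  have hsub : Measurable fun x : G × G => x.1 - x.2 := measurable_fst.sub measurable_snd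
  have hae : ∀ᵐ z ∂ν, (fun w => g (z - w)) =ᵐ[μ] fun w => f (z - w) := by
    have h1 := (quasiMeasurePreserving_sub_of_right_invariant ν μ).ae_eq_comp hfg
    filter_upwards [Measure.ae_ae_of_ae_prod h1] with z hz
    filter_upwards [hz] with w hw using hw.symm
  have hgsub : StronglyMeasurable fun x : G × G => g (x.1 - x.2) := hg.comp_measurable hsub
  have hNm : Measurable fun z => (∫⁻ w, ‖g (z - w)‖ₑ ∂μ) ^ q :=
    (Measurable.lintegral_prod_right' (f := fun x : G × G => ‖g (x.1 - x.2)‖ₑ)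
      hgsub.measurable.enorm).pow_const q
  have hconv : convMeasure g μ =ᵐ[ν] convMeasure f μ := by
    filter_upwards [hae] with z hz using integral_congr_ae hz
  refine ⟨?_, MemLp.ae_eq hconv ⟨?_, ?_⟩⟩
  · filter_upwards [hae, ae_lt_top hNm hfin.ne] with z hz hlt
    refine Integrable.congr ⟨?_, ?_⟩ hz
    · exact (hgsub.comp_measurable measurable_prodMk_left).aestronglyMeasurable
    · exact (ENNReal.rpow_lt_top_iff_of_pos hq).1 hlt
  · exact hgsub.integral_prod_right'.aestronglyMeasurable
  · rw [eLpNorm_lt_top_iff_lintegral_rpow_enorm_lt_top (by simpa using hq) ENNReal.ofReal_ne_top,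
      ENNReal.toReal_ofReal hq.le]
    refine lt_of_le_of_lt (lintegral_mono fun z => ?_) hfin
    exact ENNReal.rpow_le_rpow (enorm_integral_le_lintegral_enorm _) hq.le

theorem mainTheorem4 {𝕜 : Type*} [RCLike 𝕜] (n n' d : ℕ) (hn : 1 ≤ n) (hn' : 1 ≤ n')
    (hd : 2 ≤ d) (p q : ℝ) (hp : p = 1 + (n' * d : ℝ) / (n + 1))
    (hq : q = ((n + d).choose d : ℝ) * p)
    (f : (Fin n → ℝ) × (Fin n' → ℝ) → 𝕜) (hf : MemLp f (ENNReal.ofReal p) volume) :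
    ∀ᵐ r : PolyTuple n n' d,
      (∀ᵐ z : (Fin n → ℝ) × (Fin n' → ℝ), Integrable (fun w => f (z - w)) (graphMeasure r)) ∧
      MemLp (convMeasure f (graphMeasure r)) (ENNReal.ofReal q) volume := by
  obtain ⟨m, rfl⟩ : ∃ m, d = m + 1 := ⟨d - 1, by omega⟩
  have hp0 : 0 < p := by rw [hp]; positivity
  have hcard : (multiIndices n (m + 1)).card = (n + (m + 1)).choose (m + 1) := by
    rw [card_multiIndices, Nat.choose_symm_add]
  have hq0 : 0 < q := by
    rw [hq]
    exact mul_pos (Nat.cast_pos.2 (Nat.choose_pos (by omega))) hp0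
  obtain ⟨g, hg, hfg⟩ := hf.1
  obtain ⟨C, hC, hT⟩ := lintegral_polyTuple_rpow_le (n := n) (by omega : 1 ≤ m + 1) hn' hp
  rw [hcard, ← hq] at hT
  have hφ : Measurable fun z => ‖g z‖ₑ := hg.measurable.enorm
  have hgp : ∫⁻ z, ‖g z‖ₑ ^ p < ⊤ := by
    have h1 := (hf.ae_eq hfg).2
    rwa [eLpNorm_lt_top_iff_lintegral_rpow_enorm_lt_top (by simpa using hp0)
      ENNReal.ofReal_ne_top, ENNReal.toReal_ofReal hp0.le] at h1
  have hFm : Measurable fun r : PolyTuple n n' (m + 1) =>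
      (∫⁻ s, ‖g (s, polyMap r s)‖ₑ) ^ q :=
    (Measurable.lintegral_prod_right' (f := fun x : PolyTuple n n' (m + 1) × (Fin n → ℝ) =>
      ‖g (x.2, polyMap x.1 x.2)‖ₑ)
      (hφ.comp (measurable_snd.prodMk measurable_polyMap_uncurry))).pow_const q
  have hFfin := ne_top_of_le_ne_top
    (ENNReal.mul_ne_top hC (ENNReal.pow_ne_top hgp.ne)) (hT _ hφ)
  filter_upwards [ae_lintegral_reflectTuple_lt_top (by omega) ⟨0, hn'⟩ hFm hFfin] with r hr
  have : (volume : Measure ((Fin n → ℝ) × (Fin n' → ℝ))).IsAddRightInvariant := by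
    rw [Measure.volume_eq_prod]
    infer_instance
  refine integrable_and_memLp_convMeasure volume (graphMeasure r) hg hfg hq0 ?_
  simpa only [lintegral_sub_graphMeasure r hφ] using hr
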